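/- Let $P$ be the transition matrix of an ergodic (it suffices: irreducible) Markov chain on $\mathcal X=\{1,\dots,n\}$ with stationary distribution $q$, let $P_i$ denote the $i$th row of $P$, and let $c\in\mathbb R^n$, $\alpha\in(0,1)$, $\lambda\in[0,1]$. Let $\Phi$ be an $n\times m$ matrix with rows $\varphi^\top(i)$. Let $\sigma$ be a transition risk mapping: for every state $i$ and every probability vector $p$, the function $v\mapsto\sigma_i(p,v)$ on $\mathbb R^n$ is convex, monotone, positively homogeneous, and satisfies $\sigma_i(p,v+b\mathbf 1)=\sigma_i(p,v)+b$ for $b\in\mathbb R$. Put $A_i=\{\mu \text{ a probability vector}: \langle\mu,v\rangle\le\sigma_i(P_i,v)\ \forall v\in\mathbb R^n\}$, assume that every $\mu\in A_i$ is absolutely continuous with respect to $P_i$, and let $$\varkappa=\max\Big\{\frac{|\mu_j-P_{ij}|}{P_{ij}}:\ i,j\in\mathcal X,\ P_{ij}>0,\ \mu\in A_i\Big\}.$$ Write $\sigma(P,v)=(\sigma_i(P_i,v))_{i\in\mathcal X}$ and $\|w\|_q^2=\sum_i q_iw_i^2$, let $L(w)=\operatorname{argmin}_{z\in\operatorname{range}(\Phi)}\|z-w\|_q$,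 and let $\bar P=(1-\lambda\alpha)\sum_{\ell=0}^\infty(\lambda\alpha)^\ell P^\ell$. On a probability space, let states $i_t$, iterates $r_t\in\mathbb R^m$, stepsizes $\gamma_t$ and risk estimates $\widetilde\sigma_t$, $t=0,1,2,\dots$, be random variables such that, with $z_{-1}=0$, $$z_t=\lambda\alpha z_{t-1}+\varphi(i_t),\qquad \widetilde d_t=\varphi^\top(i_t)r_t-c_{i_t}-\alpha\widetilde\sigma_t,\qquad r_{t+1}=r_t-\gamma_tz_t\widetilde d_t .$$ Let $\mathcal F_t$ be the $\sigma$-algebra generated by $i_0,r_0,\dots,i_t,r_t$. Suppose that: 1. $\mathbb P(i_{t+1}=j\mid\mathcal F_t)=P_{i_tj}$ a.s. for all $t$ and $j$. 2. $\widetilde\sigma_t=\sigma_{i_t}(P_{i_t},\Phi r_t)+\xi_t$, where $\mathbb E[\xi_t\mid\mathcal F_t]=0$ and $\mathbb E[\xi_t^2\mid\mathcal F_t]\le K$ a.s. for all $t$, with a constant $K$. 3. $\gamma_t$ is $\mathcal F_t$-measurable; a.s. $\gamma_t>0$ for all $t$, $\gamma_t\to0$ and $\sum_t\gamma_t=\infty$;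 $\mathbb E\sum_t\gamma_t^2<\infty$; and for every $\varepsilon>0$, a.s. $$\lim_{t_0\to\infty}\ \sup_{\{T:\ \sum_{t=t_0}^T\gamma_t\le\varepsilon\}}\ \sum_{t=t_0}^T|\gamma_t-\gamma_{t+1}|=0 .$$ 4. The sequence $\{r_t\}$ is bounded with probability $1$. If $\alpha(1+\varkappa)<1$, then, with probability $1$, every accumulation point $r$ of $\{r_t\}$ is a solution of $$L\bar P\Phi r=L\bar P\big(c+\alpha\,\sigma(P,\Phi r)\big).$$ -/

import Mathlib

open MeasureTheory ProbabilityTheory Filter Topology Matrix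

/-! ### Transition risk mappings -/

/-- A coherent measure of risk on functions over the finite state space. -/
structure IsCoherentRisk {n : ℕ} (ρ : (Fin n → ℝ) → ℝ) : Prop where
  convex : ∀ v w : Fin n → ℝ, ∀ θ : ℝ, 0 ≤ θ → θ ≤ 1 →
    ρ (θ • v + (1 - θ) • w) ≤ θ * ρ v + (1 - θ) * ρ w
  monotone : ∀ v w : Fin n → ℝ, v ≤ w → ρ v ≤ ρ w
  translation : ∀ (v : Fin n → ℝ) (b : ℝ), ρ (v + fun _ => b) = ρ v + b
  pos_homogeneous : ∀ (b : ℝ) (v : Fin n → ℝ), 0 ≤ b → ρ (b • v) = b * ρ v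

/-- `σ i p v` is the risk of `v` at the state `i` when the next state has the law `p`. It is a
transition risk mapping if `σ i p` is coherent for every state `i` and every law `p`. -/
def IsTransitionRiskMapping {n : ℕ} (σ : Fin n → (Fin n → ℝ) → (Fin n → ℝ) → ℝ) : Prop :=
  ∀ i, ∀ p ∈ stdSimplex ℝ (Fin n), IsCoherentRisk (σ i p)

/-- The risk multikernel `A_i(p) = ∂σ_i(p, 0)`: the probability vectors `μ` which satisfy
`⟨μ, v⟩ ≤ σ_i(p, v)` for every `v`. -/
def riskMultikernel {n : ℕ} (σ : Fin n → (Fin n → ℝ) → (Fin n → ℝ) → ℝ) (i : Fin n)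
    (p : Fin n → ℝ) : Set (Fin n → ℝ) :=
  {μ | μ ∈ stdSimplex ℝ (Fin n) ∧ ∀ v : Fin n → ℝ, μ ⬝ᵥ v ≤ σ i p v}

/-- The distortion coefficient `ϰ`. -/
noncomputable def distortionCoeff {n : ℕ} (σ : Fin n → (Fin n → ℝ) → (Fin n → ℝ) → ℝ)
    (P : Matrix (Fin n) (Fin n) ℝ) : ℝ :=
  sSup {x : ℝ | ∃ i j, ∃ μ ∈ riskMultikernel σ i (P i), 0 < P i j ∧
    x = |μ j - P i j| / P i j}

/-- The transition risk operator `v ↦ σ(P, v)`. -/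
def riskOperator {n : ℕ} (σ : Fin n → (Fin n → ℝ) → (Fin n → ℝ) → ℝ)
    (P : Matrix (Fin n) (Fin n) ℝ) (v : Fin n → ℝ) : Fin n → ℝ :=
  fun i => σ i (P i) v

/-! ### The projection and the multistep transition matrix -/

/-- `q` is a stationary probability vector of `P`. -/
def IsStationaryLaw {n : ℕ} (P : Matrix (Fin n) (Fin n) ℝ) (q : Fin n → ℝ) : Prop :=
  q ∈ stdSimplex ℝ (Fin n) ∧ q ᵥ* P = q

/-- The norm `‖w‖_q`. -/
noncomputable def qNorm {n : ℕ} (q w : Fin n → ℝ) : ℝ :=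
  Real.sqrt (∑ i, q i * w i ^ 2)

/-- `z` is a point of `range Φ` at the least `‖·‖_q`-distance from `w`. -/
def IsQProjection {n m : ℕ} (q : Fin n → ℝ) (Φ : Matrix (Fin n) (Fin m) ℝ)
    (w z : Fin n → ℝ) : Prop :=
  z ∈ Set.range (fun r : Fin m → ℝ => Φ *ᵥ r) ∧
    ∀ r : Fin m → ℝ, qNorm q (z - w) ≤ qNorm q (Φ *ᵥ r - w)

/-- The projection `L(w) = argmin {‖z - w‖_q : z ∈ range Φ}`; the minimizer exists and is unique
when all `q i` are positive, see `existsUnique_isQProjection`. -/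
noncomputable def qProjection {n m : ℕ} (q : Fin n → ℝ) (Φ : Matrix (Fin n) (Fin m) ℝ)
    (w : Fin n → ℝ) : Fin n → ℝ :=
  Classical.epsilon (IsQProjection q Φ w)

theorem existsUnique_isQProjection {n m : ℕ} (q : Fin n → ℝ) (hq : ∀ i, 0 < q i)
    (Φ : Matrix (Fin n) (Fin m) ℝ) (w : Fin n → ℝ) : ∃! z, IsQProjection q Φ w z := by
  let D : (Fin n → ℝ) →ₗ[ℝ] EuclideanSpace ℝ (Fin n) :=
    { toFun := fun v => WithLp.toLp 2 (fun i => Real.sqrt (q i) * v i)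
      map_add' := by
        intro a b; ext i; simp [mul_add]
      map_smul' := by
        intro a b; ext i; simp; ring }
  have hD : ∀ v, ‖D v‖ = qNorm q v := by
    intro v
    simp only [EuclideanSpace.norm_eq, qNorm]
    congr 1
    refine Finset.sum_congr rfl fun i _ => ?_
    simp [D, mul_pow, Real.sq_sqrt (hq i).le]
  have hinj : Function.Injective D := by
    intro a b h
    ext i
    have h1 := congrArg (fun x : EuclideanSpace ℝ (Fin n) => x i) h
    simpa [D, (Real.sqrt_pos.2 (hq i)).ne'] using h1
  let K : Submodule ℝ (EuclideanSpace ℝ (Fin n)) := LinearMap.range (D ∘ₗ Φ.mulVecLin)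
  obtain ⟨r0, hr0⟩ : K.starProjection (D w) ∈ LinearMap.range (D ∘ₗ Φ.mulVecLin) :=
    Submodule.starProjection_apply_mem K (D w)
  have hr0' : D (Φ *ᵥ r0) = K.starProjection (D w) := by simpa using hr0
  have hpy : ∀ r, qNorm q (Φ *ᵥ r - w) ^ 2 =
      qNorm q (Φ *ᵥ r - Φ *ᵥ r0) ^ 2 + qNorm q (Φ *ᵥ r0 - w) ^ 2 := by
    intro r
    rw [← hD, ← hD, ← hD]
    have horth : inner ℝ (D (Φ *ᵥ r - Φ *ᵥ r0)) (D (Φ *ᵥ r0 - w)) = 0 := by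
      have hmem : D (Φ *ᵥ r - Φ *ᵥ r0) ∈ K := ⟨r - r0, by simp [Matrix.mulVec_sub]⟩
      have h2 := Submodule.starProjection_inner_eq_zero (K := K) (D w) _ hmem
      rw [← hr0', ← map_sub] at h2
      rw [real_inner_comm, ← neg_sub w, map_neg, inner_neg_left, h2, neg_zero]
    have h3 := norm_add_sq_real (D (Φ *ᵥ r - Φ *ᵥ r0)) (D (Φ *ᵥ r0 - w))
    rw [horth, ← map_add, sub_add_sub_cancel] at h3
    linarith
  have hnn : ∀ v, 0 ≤ qNorm q v := fun v => Real.sqrt_nonneg _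
  refine ⟨Φ *ᵥ r0, ⟨⟨r0, rfl⟩, fun r => ?_⟩, ?_⟩
  · refine le_of_sq_le_sq ?_ (hnn _)
    rw [hpy r]
    nlinarith [sq_nonneg (qNorm q (Φ *ᵥ r - Φ *ᵥ r0))]
  · rintro z ⟨⟨r, rfl⟩, hz⟩
    have h1 : qNorm q (Φ *ᵥ r - w) ^ 2 ≤ qNorm q (Φ *ᵥ r0 - w) ^ 2 :=
      pow_le_pow_left₀ (hnn _) (hz r0) 2
    rw [hpy r] at h1
    have h2 : qNorm q (Φ *ᵥ r - Φ *ᵥ r0) = 0 := by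
      have := sq_nonneg (qNorm q (Φ *ᵥ r - Φ *ᵥ r0))
      exact pow_eq_zero_iff (two_ne_zero) |>.1 (by linarith)
    rw [← hD, norm_eq_zero, map_sub, sub_eq_zero] at h2
    exact hinj h2

/-- The multistep transition matrix `(1 - β) ∑ β^ℓ P^ℓ`. -/
noncomputable def multistepMatrix {n : ℕ} (β : ℝ) (P : Matrix (Fin n) (Fin n) ℝ) :
    Matrix (Fin n) (Fin n) ℝ :=
  (1 - β) • ∑' ℓ : ℕ, β ^ ℓ • P ^ ℓ

/-- `r` solves `L P̄ Φ r = L P̄ (c + α σ(P, Φ r))`, where `P̄` is the multistep matrix with the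
parameter `lam * α`. -/
def SolvesProjectedMultistepEquation {n m : ℕ} (σ : Fin n → (Fin n → ℝ) → (Fin n → ℝ) → ℝ)
    (P : Matrix (Fin n) (Fin n) ℝ) (q c : Fin n → ℝ) (Φ : Matrix (Fin n) (Fin m) ℝ)
    (α lam : ℝ) (r : Fin m → ℝ) : Prop :=
  qProjection q Φ (multistepMatrix (lam * α) P *ᵥ (Φ *ᵥ r)) =
    qProjection q Φ (multistepMatrix (lam * α) P *ᵥ (c + α • riskOperator σ P (Φ *ᵥ r)))

/-! ### The stochastic method -/

/-- The eligibility trace `z_t = β z_{t-1} + φ(x_t)`, `z_{-1} = 0`, along a path `x` of states;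
the row `Φ i` is the feature vector of the state `i`. -/
def eligibilityTrace {n m : ℕ} (Φ : Matrix (Fin n) (Fin m) ℝ) (β : ℝ) (x : ℕ → Fin n) :
    ℕ → Fin m → ℝ
  | 0 => β • (0 : Fin m → ℝ) + Φ (x 0)
  | t + 1 => β • eligibilityTrace Φ β x t + Φ (x (t + 1))

/-- The σ-algebra `F_t` generated by `x_0, r_0, …, x_t, r_t`. -/
@[reducible] def historySigma {Ω : Type*} {n m : ℕ} (x : ℕ → Ω → Fin n) (r : ℕ → Ω → Fin m → ℝ) (t : ℕ) :
    MeasurableSpace Ω :=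
  ⨆ s ∈ Set.Iic t, (MeasurableSpace.comap (x s) ⊤ ⊔ MeasurableSpace.comap (r s) inferInstance)

/-- With respect to the σ-algebras `F t`, `x` is a Markov chain with the transition matrix `P`. -/
def IsMarkovTrajectory {Ω : Type*} {_ : MeasurableSpace Ω} (μ : Measure Ω) {n : ℕ}
    (F : ℕ → MeasurableSpace Ω) (P : Matrix (Fin n) (Fin n) ℝ) (x : ℕ → Ω → Fin n) : Prop :=
  ∀ t j, μ[(x (t + 1) ⁻¹' {j}).indicator (fun _ => (1 : ℝ)) | F t] =ᵐ[μ] fun ω => P (x t ω) j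

/-- The conditions on the (random) stepsizes. -/
structure StepsizeConditions {Ω : Type*} {_ : MeasurableSpace Ω} (μ : Measure Ω)
    (F : ℕ → MeasurableSpace Ω) (γ : ℕ → Ω → ℝ) : Prop where
  adapted : ∀ t, Measurable[F t] (γ t)
  pos : ∀ᵐ ω ∂μ, ∀ t, 0 < γ t ω
  tendsto_zero : ∀ᵐ ω ∂μ, Tendsto (fun t => γ t ω) atTop (𝓝 0)
  sum_eq_top : ∀ᵐ ω ∂μ, Tendsto (fun T => ∑ t ∈ Finset.range T, γ t ω) atTop atTop
  sum_sq : ∫⁻ ω, ∑' t, ENNReal.ofReal (γ t ω ^ 2) ∂μ < ⊤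
  /-- `lim_{t₀ → ∞} sup {∑_{t=t₀}^T |γ_t - γ_{t+1}| : ∑_{t=t₀}^T γ_t ≤ ε} = 0` a.s. -/
  slowly_varying : ∀ ε > (0 : ℝ), ∀ᵐ ω ∂μ, ∀ δ > (0 : ℝ), ∀ᶠ t₀ in atTop, ∀ T,
    ∑ t ∈ Finset.Icc t₀ T, γ t ω ≤ ε → ∑ t ∈ Finset.Icc t₀ T, |γ t ω - γ (t + 1) ω| ≤ δ

/-- The conditions on the errors of the risk estimates. -/
structure ErrorConditions {Ω : Type*} {_ : MeasurableSpace Ω} (μ : Measure Ω)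
    (F : ℕ → MeasurableSpace Ω) (ξ : ℕ → Ω → ℝ) : Prop where
  memLp : ∀ t, MemLp (ξ t) 2 μ
  mean_zero : ∀ t, μ[ξ t | F t] =ᵐ[μ] 0
  variance_bound : ∃ K : ℝ, ∀ t, ∀ᵐ ω ∂μ, (μ[fun ω' => ξ t ω' ^ 2 | F t]) ω ≤ K

/-! Averaged over the stationary law, the method follows the field `meanField`: r ↦ Φᵀ diag(q) R (Φr
− c − ασ(P, Φr)), where R = ∑ β^ℓ P^ℓ with β = λα accounts for the trace. Since P̄ = (1 − β)R, a
zero of the field makes the two sides of the equation, before projection, differ by a vector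
q-orthogonal to range Φ, so their projections agree (`solves_of_meanField_eq_zero`).

The field is strongly monotone in the seminorm ‖Φ·‖_q (`exists_strongMonotone_meanField`). For u =
Φ(r − s), R maps the increment of the temporal differences to u + Rk, where k = βPu − α(σ(P, Φr) −
σ(P, Φs)). The dual representation of σ and the definition of ϰ give |k| ≤ (α(1 + ϰ) − β) P|u|. In
‖·‖_q, P is nonexpansive and R has norm at most 1/(1 − β), so ‖Rk‖_q ≤ ρ‖u‖_q with ρ = (α(1 + ϰ) −
β)/(1 − β), which is below 1 because α(1 + ϰ) < 1. On the orthogonal complement of ker Φ the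
seminorm is a norm, which removes any need for full rank of Φ.

The Markov noise is handled through a Poisson equation for the pair (state, trace): by
`tracePotential_sub_expected`, the deviation of the update direction from the mean field is the
expected decrement of a potential S, hence a difference of consecutive potentials plus a martingale
difference. Summation by parts leaves (γ_t − γ_{t+1}) S_{t+1}, which is small over windows of
bounded total stepsize. The martingale parts, including the estimation errors, form convergent
series because ∑ γ_t² has finite expectation. The remaining deterministic recursion contracts
towards the zero of the field by a fixed factor over each window
(`exists_tendsto_zero_of_strongMonotone`). Thus the projected iterates converge, and every
accumulation point is a zero of the field. -/

/-! ### Scalar recursions over windows of bounded total stepsize. -/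

/-- Discrete Gronwall inequality for `X (t+1) ≤ exp (-c γ t) X t + b t`. -/
theorem le_exp_mul_add_sum_of_step {X γ b : ℕ → ℝ} {c : ℝ} (hc : 0 < c) {N : ℕ}
    (hγ : ∀ t ≥ N, 0 ≤ γ t) (hb : ∀ t ≥ N, 0 ≤ b t)
    (hstep : ∀ t ≥ N, X (t + 1) ≤ Real.exp (-(c * γ t)) * X t + b t)
    {s : ℕ} (hs : N ≤ s) (t : ℕ) (ht : s ≤ t) :
    X t ≤ Real.exp (-(c * ∑ k ∈ Finset.Ico s t, γ k)) * X s + ∑ k ∈ Finset.Ico s t, b k := by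
  induction t, ht using Nat.le_induction with
  | base => simp
  | succ t ht ih =>
    rw [Finset.sum_Ico_succ_top ht, Finset.sum_Ico_succ_top ht]
    have h1 := hstep t (hs.trans ht)
    have hS : 0 ≤ ∑ k ∈ Finset.Ico s t, b k :=
      Finset.sum_nonneg fun k hk => hb k (hs.trans (Finset.mem_Ico.1 hk).1)
    have h2 : Real.exp (-(c * γ t)) ≤ 1 := by
      rw [Real.exp_le_one_iff]
      have := hγ t (hs.trans ht)
      nlinarith
    have h3 := mul_le_mul_of_nonneg_left ih (Real.exp_pos (-(c * γ t))).le
    have h4 : Real.exp (-(c * (∑ k ∈ Finset.Ico s t, γ k + γ t))) =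
        Real.exp (-(c * γ t)) * Real.exp (-(c * ∑ k ∈ Finset.Ico s t, γ k)) := by
      rw [← Real.exp_add]; ring_nf
    rw [h4]
    nlinarith [mul_le_mul_of_nonneg_right h2 hS]

/-- Far along the way, every time has a window before it of total stepsize between `1` and `2`. -/
theorem exists_backward_window {γ : ℕ → ℝ} (h0 : Tendsto γ atTop (𝓝 0))
    (hsum : Tendsto (fun T => ∑ t ∈ Finset.range T, γ t) atTop atTop) (N : ℕ) :
    ∀ᶠ t in atTop, ∃ s, N ≤ s ∧ s < t ∧ 1 ≤ ∑ k ∈ Finset.Ico s t, γ k ∧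
      ∑ k ∈ Finset.Ico s t, γ k ≤ 2 := by
  classical
  obtain ⟨N', hN'⟩ := eventually_atTop.1 (h0.eventually_le_const (show (0 : ℝ) < 1 by norm_num))
  set M := max N N'
  filter_upwards [hsum.eventually_ge_atTop ((∑ k ∈ Finset.range M, γ k) + 1),
    eventually_ge_atTop M] with t ht hMt
  let Q : ℕ → Prop := fun s => 1 ≤ ∑ k ∈ Finset.Ico s t, γ k
  have hQM : Q M := by
    have := Finset.sum_range_add_sum_Ico γ hMt
    simp only [Q]; linarith
  -- For the latest start with total at least 1, dropping the term at `s` brings the total below 1.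
  -- That term is at most 1, whence the bound 2.
  set s := Nat.findGreatest Q t
  have hs : Q s := Nat.findGreatest_spec hMt hQM
  have hMs : M ≤ s := Nat.le_findGreatest hMt hQM
  have hst : s < t := by
    by_contra h
    have : Finset.Ico s t = ∅ := Finset.Ico_eq_empty h
    simp only [Q, this, Finset.sum_empty] at hs
    norm_num at hs
  have hns : ¬ Q (s + 1) := Nat.findGreatest_is_greatest (Nat.lt_succ_self s) hst
  refine ⟨s, (le_max_left _ _).trans hMs, hst, hs, ?_⟩
  rw [Finset.sum_eq_sum_Ico_succ_bot hst]
  simp only [Q, not_le] at hns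
  have := hN' s ((le_max_right _ _).trans hMs)
  linarith

/-- A perturbed contraction, whose perturbations vanish on windows of bounded total stepsize,
converges to zero. -/
theorem tendsto_zero_of_windowed_contraction {X γ b : ℕ → ℝ} {c B : ℝ} (hc : 0 < c)
    (hpos : ∀ t, 0 < γ t) (h0 : Tendsto γ atTop (𝓝 0))
    (hsum : Tendsto (fun T => ∑ t ∈ Finset.range T, γ t) atTop atTop)
    (hX : ∀ t, 0 ≤ X t) (hXB : ∀ t, X t ≤ B) (hb : ∀ t, 0 ≤ b t)
    (hwin : ∀ δ > 0, ∀ᶠ s in atTop, ∀ t, ∑ k ∈ Finset.Ico s t, γ k ≤ 2 →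
      ∑ k ∈ Finset.Ico s t, b k ≤ δ)
    (hstep : ∀ᶠ t in atTop, X (t + 1) ≤ Real.exp (-(c * γ t)) * X t + b t) :
    Tendsto X atTop (𝓝 0) := by
  have hθ : Real.exp (-c) < 1 := by rw [Real.exp_lt_one_iff]; linarith
  have hθ0 := Real.exp_pos (-c)
  -- One window improves any eventual bound by the factor exp(-c), up to δ. Applied just above the
  -- limsup, this forces the limsup to be nonpositive.
  have key : ∀ M δ : ℝ, 0 < δ → (∀ᶠ t in atTop, X t ≤ M) →
      ∀ᶠ t in atTop, X t ≤ Real.exp (-c) * M + δ := by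
    intro M δ hδ hM
    obtain ⟨N, hN⟩ := eventually_atTop.1 (hM.and ((hwin δ hδ).and hstep))
    filter_upwards [exists_backward_window h0 hsum N] with t ⟨s, hNs, hst, h1, h2⟩
    have hg := le_exp_mul_add_sum_of_step hc (fun t _ => (hpos t).le) (fun t _ => hb t)
      (fun t ht => (hN t ht).2.2) hNs t hst.le
    have hw := (hN s hNs).2.1 t h2
    have hMs := (hN s hNs).1
    have he : Real.exp (-(c * ∑ k ∈ Finset.Ico s t, γ k)) ≤ Real.exp (-c) := by
      apply Real.exp_le_exp.2; nlinarith
    nlinarith [mul_le_mul he hMs (hX s) hθ0.le]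
  have hbu : IsBoundedUnder (· ≤ ·) atTop X := isBoundedUnder_of ⟨B, hXB⟩
  have hbl : IsBoundedUnder (· ≥ ·) atTop X := isBoundedUnder_of ⟨0, hX⟩
  set M := limsup X atTop
  have hM : M ≤ 0 := by
    by_contra hM
    push Not at hM
    -- With this δ the improved bound reads M ≤ exp(-c) M + 2δ at worst, that is 4δ ≤ 2δ.
    set δ := (1 - Real.exp (-c)) * M / 4
    have hδ : 0 < δ := by positivity [sub_pos.2 hθ]
    have h1 : ∀ᶠ t in atTop, X t ≤ M + δ :=
      (eventually_lt_of_limsup_lt (show M < M + δ by linarith) hbu).mono fun _ h => h.le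
    have h2 : M ≤ Real.exp (-c) * (M + δ) + δ := limsup_le_of_le hbl.isCoboundedUnder_le (key _ δ hδ h1)
    have h3 : Real.exp (-c) * δ ≤ δ := by nlinarith
    have h4 : 4 * δ = (1 - Real.exp (-c)) * M := by simp only [δ]; ring
    nlinarith
  refine tendsto_of_le_liminf_of_limsup_le ?_ hM hbu hbl
  exact le_liminf_of_le hbu.isCoboundedUnder_ge (Eventually.of_forall hX)

/-! ### Strongly monotone Lipschitz fields in a Hilbert space. -/

section Hilbert
variable {E : Type*} [NormedAddCommGroup E] [InnerProductSpace ℝ E]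

/-- Expanding the square gives the factor 1 - 2sc + s²L². The condition sL² ≤ c reduces it to 1 -
sc, which is at most (1 - sc/2)². -/
theorem norm_sub_step_le_of_strongMonotone {h : E → E} {c L : ℝ} 
    (hmono : ∀ x y, c * ‖x - y‖ ^ 2 ≤ inner ℝ (x - y) (h x - h y))
    (hlip : ∀ x y, ‖h x - h y‖ ≤ L * ‖x - y‖) {s : ℝ} (hs : 0 ≤ s) (hsL : s * L ^ 2 ≤ c)
    (hsc : s * c ≤ 2) (x y : E) :
    ‖(x - s • h x) - (y - s • h y)‖ ≤ (1 - s * c / 2) * ‖x - y‖ := by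
  have h1 : (x - s • h x) - (y - s • h y) = (x - y) - s • (h x - h y) := by
    rw [smul_sub]; abel
  have h2 : ‖(x - y) - s • (h x - h y)‖ ^ 2 = ‖x - y‖ ^ 2 - 2 * (s * inner ℝ (x - y) (h x - h y))
      + s ^ 2 * ‖h x - h y‖ ^ 2 := by
    rw [norm_sub_sq_real, inner_smul_right, norm_smul, mul_pow, Real.norm_eq_abs, sq_abs]
  rw [h1]
  refine le_of_sq_le_sq ?_ (mul_nonneg (by linarith) (norm_nonneg _))
  rw [h2]
  have h3 : ‖h x - h y‖ ^ 2 ≤ L ^ 2 * ‖x - y‖ ^ 2 := by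
    rw [← mul_pow]; exact pow_le_pow_left₀ (norm_nonneg _) (hlip x y) 2
  have h4 := mul_le_mul_of_nonneg_left (hmono x y) hs
  have h5 := mul_le_mul_of_nonneg_left h3 (sq_nonneg s)
  have h6 : s ^ 2 * (L ^ 2 * ‖x - y‖ ^ 2) ≤ s * c * ‖x - y‖ ^ 2 := by
    have := mul_le_mul_of_nonneg_left hsL hs
    nlinarith [mul_le_mul_of_nonneg_right this (sq_nonneg ‖x - y‖)]
  nlinarith [mul_nonneg (sq_nonneg (s * c / 2)) (sq_nonneg ‖x - y‖)]

/-- A short explicit Euler step is a contraction, and its Banach fixed point is the zero. -/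
theorem exists_zero_of_strongMonotone [CompleteSpace E] {h : E → E} {c L : ℝ} (hc : 0 < c)
    (hmono : ∀ x y, c * ‖x - y‖ ^ 2 ≤ inner ℝ (x - y) (h x - h y))
    (hlip : ∀ x y, ‖h x - h y‖ ≤ L * ‖x - y‖) : ∃ y, h y = 0 := by
  set s : ℝ := min (c / (L ^ 2 + 1)) (1 / c)
  have hs : 0 < s := lt_min (by positivity) (by positivity)
  have hsL : s * L ^ 2 ≤ c := by
    have h1 : s * (L ^ 2 + 1) ≤ c := by
      rw [← le_div_iff₀ (by positivity)]; exact min_le_left _ _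
    nlinarith
  have hsc : s * c ≤ 1 := by
    rw [← le_div_iff₀ hc]; exact min_le_right _ _
  have hcon : ContractingWith (Real.toNNReal (1 - s * c / 2)) (fun y => y - s • h y) := by
    constructor
    · rw [Real.toNNReal_lt_one]; nlinarith [mul_pos hs hc]
    · refine LipschitzWith.of_dist_le_mul fun x y => ?_
      rw [dist_eq_norm, dist_eq_norm, Real.coe_toNNReal _ (by linarith)]
      exact norm_sub_step_le_of_strongMonotone hmono hlip hs.le hsL (by linarith) x y
  refine ⟨hcon.fixedPoint, ?_⟩
  have hfix := hcon.fixedPoint_isFixedPt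
  simp only [Function.IsFixedPt, sub_eq_self, smul_eq_zero] at hfix
  exact hfix.resolve_left hs.ne'

/-- A perturbed stochastic approximation recursion for a strongly monotone Lipschitz field
converges to the zero of the field. -/
theorem exists_tendsto_zero_of_strongMonotone [CompleteSpace E] {h : E → E} {c L : ℝ}
    (hc : 0 < c) (hL : 0 ≤ L)
    (hmono : ∀ x y, c * ‖x - y‖ ^ 2 ≤ inner ℝ (x - y) (h x - h y))
    (hlip : ∀ x y, ‖h x - h y‖ ≤ L * ‖x - y‖)
    {γ : ℕ → ℝ} (hpos : ∀ t, 0 < γ t) (h0 : Tendsto γ atTop (𝓝 0))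
    (hsum : Tendsto (fun T => ∑ t ∈ Finset.range T, γ t) atTop atTop)
    {y e b : ℕ → E} {B : ℝ} (hy : ∀ t, ‖y t‖ ≤ B) (he : Tendsto e atTop (𝓝 0))
    (hwin : ∀ δ > 0, ∀ᶠ s in atTop, ∀ t, ∑ k ∈ Finset.Ico s t, γ k ≤ 2 →
      ∑ k ∈ Finset.Ico s t, ‖b k‖ ≤ δ)
    (hstep : ∀ t, y (t + 1) + e (t + 1) = y t + e t - γ t • h (y t) + b t) :
    ∃ y₀, h y₀ = 0 ∧ Tendsto y atTop (𝓝 y₀) := by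
  obtain ⟨y₀, hy₀⟩ := exists_zero_of_strongMonotone hc hmono hlip
  refine ⟨y₀, hy₀, ?_⟩
  obtain ⟨Be, hBe⟩ := he.norm.bddAbove_range
  -- The contraction is run for the shifted iterate y + e. Evaluating `h` at y instead of y + e
  -- costs γ L ‖e‖, which is negligible over windows since e tends to zero.
  have hX : Tendsto (fun t => ‖y t + e t - y₀‖) atTop (𝓝 0) := by
    refine tendsto_zero_of_windowed_contraction (c := c / 2) (B := B + Be + ‖y₀‖)
      (b := fun t => γ t * (L * ‖e t‖) + ‖b t‖) (by positivity) hpos h0 hsum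
      (fun t => norm_nonneg _) ?_ ?_ ?_ ?_
    · intro t
      have := hBe ⟨t, rfl⟩
      have h1 := norm_sub_le (y t + e t) y₀
      have h2 := norm_add_le (y t) (e t)
      have := hy t
      simp only at *
      linarith
    · intro t
      have := (hpos t).le
      positivity
    · intro δ hδ
      have h1 : Tendsto (fun t => L * ‖e t‖) atTop (𝓝 0) := by
        simpa using he.norm.const_mul L
      -- A window has total stepsize at most 2, so δ/4 per unit of stepsize uses up δ/2.
      obtain ⟨N, hN⟩ := eventually_atTop.1 (h1.eventually_le_const (show 0 < δ / 4 by positivity))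
      filter_upwards [hwin (δ / 2) (by positivity), eventually_ge_atTop N] with s hs hNs t ht
      have h2 := hs t ht
      have h3 : ∑ k ∈ Finset.Ico s t, γ k * (L * ‖e k‖) ≤ ∑ k ∈ Finset.Ico s t, γ k * (δ / 4) :=
        Finset.sum_le_sum fun k hk => mul_le_mul_of_nonneg_left
          (hN k (hNs.trans (Finset.mem_Ico.1 hk).1)) (hpos k).le
      rw [← Finset.sum_mul] at h3
      rw [Finset.sum_add_distrib]
      nlinarith
    · have h1 : Tendsto (fun t => γ t * L ^ 2) atTop (𝓝 0) := by simpa using h0.mul_const (L ^ 2)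
      have h2 : Tendsto (fun t => γ t * c) atTop (𝓝 0) := by simpa using h0.mul_const c
      filter_upwards [h1.eventually_le_const hc, h2.eventually_le_const (show (0 : ℝ) < 2 by norm_num)]
        with t ht1 ht2
      have h3 := norm_sub_step_le_of_strongMonotone hmono hlip (hpos t).le ht1 ht2 (y t + e t) y₀
      rw [hy₀, smul_zero, sub_zero] at h3
      have h4 : y (t + 1) + e (t + 1) - y₀ = ((y t + e t) - γ t • h (y t + e t) - y₀) +
          γ t • (h (y t + e t) - h (y t)) + b t := by
        rw [hstep t, smul_sub]; abel
      rw [h4]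
      have h5 : ‖γ t • (h (y t + e t) - h (y t))‖ ≤ γ t * (L * ‖e t‖) := by
        rw [norm_smul, Real.norm_of_nonneg (hpos t).le]
        refine mul_le_mul_of_nonneg_left ?_ (hpos t).le
        simpa using hlip (y t + e t) (y t)
      have h6 : 1 - γ t * c / 2 ≤ Real.exp (-(c / 2 * γ t)) := by
        have := Real.add_one_le_exp (-(c / 2 * γ t))
        linarith
      have h7 := mul_le_mul_of_nonneg_right h6 (norm_nonneg (y t + e t - y₀))
      refine (norm_add₃_le).trans ?_
      linarith
  have h1 : Tendsto (fun t => (y t + e t - y₀) - e t + y₀) atTop (𝓝 (0 - 0 + y₀)) :=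
    ((tendsto_zero_iff_norm_tendsto_zero.2 hX).sub he).add_const y₀
  rw [sub_zero, zero_add] at h1
  refine h1.congr fun t => ?_
  abel

end Hilbert

/-! ### Coherent risk measures and their supporting functionals. -/

section Risk
variable {n : ℕ} {ρ : (Fin n → ℝ) → ℝ}

theorem IsCoherentRisk.map_zero (h : IsCoherentRisk ρ) : ρ 0 = 0 := by
  simpa using h.pos_homogeneous 0 0 le_rfl

theorem IsCoherentRisk.add_le (h : IsCoherentRisk ρ) (v w : Fin n → ℝ) : ρ (v + w) ≤ ρ v + ρ w := by
  have h1 := h.convex ((2 : ℝ) • v) ((2 : ℝ) • w) (1 / 2) (by norm_num) (by norm_num)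
  rw [h.pos_homogeneous 2 v (by norm_num), h.pos_homogeneous 2 w (by norm_num), smul_smul,
    smul_smul] at h1
  norm_num at h1
  linarith

theorem IsCoherentRisk.abs_sub_le (h : IsCoherentRisk ρ) (v w : Fin n → ℝ) :
    |ρ v - ρ w| ≤ ‖v - w‖ := by
  have key : ∀ v w : Fin n → ℝ, ρ v ≤ ρ w + ‖v - w‖ := fun v w => by
    rw [← h.translation]
    refine h.monotone _ _ fun i => ?_
    have := (le_abs_self _).trans (norm_le_pi_norm (v - w) i)
    simp only [Pi.sub_apply, Pi.add_apply] at *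
    linarith
  rw [abs_le]
  have h1 := key v w
  have h2 := key w v
  rw [norm_sub_rev] at h2
  constructor <;> linarith

/-- A coherent risk measure is supported by a linear functional which it dominates. -/
theorem IsCoherentRisk.exists_linear_le (h : IsCoherentRisk ρ) (v : Fin n → ℝ) :
    ∃ g : (Fin n → ℝ) →ₗ[ℝ] ℝ, g v = ρ v ∧ ∀ w, g w ≤ ρ w := by
  by_cases hv : v = 0
  · obtain ⟨g, -, hg⟩ := exists_extension_of_le_sublinear (⊥ : (Fin n → ℝ) →ₗ.[ℝ] ℝ) ρ
      (fun c hc x => h.pos_homogeneous c x hc.le) h.add_le (by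
        rintro ⟨x, hx⟩
        obtain rfl : x = 0 := (Submodule.mem_bot ℝ).1 hx
        have : (⊥ : (Fin n → ℝ) →ₗ.[ℝ] ℝ) ⟨0, hx⟩ = 0 := LinearPMap.map_zero _
        rw [this, h.map_zero])
    exact ⟨g, by rw [hv, g.map_zero, h.map_zero], hg⟩
  · obtain ⟨g, hgv, hg⟩ := exists_extension_of_le_sublinear
      (LinearPMap.mkSpanSingleton v (ρ v) hv) ρ
      (fun c hc x => h.pos_homogeneous c x hc.le) h.add_le (by
        rintro ⟨x, hx⟩
        obtain ⟨t, rfl⟩ := Submodule.mem_span_singleton.1 hx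
        rw [LinearPMap.mkSpanSingleton'_apply]
        change t * ρ v ≤ ρ (t • v)
        rcases le_total 0 t with ht | ht
        · exact (h.pos_homogeneous t v ht).ge
        -- For negative multiples domination comes from 0 = ρ(0) ≤ ρ(tv) + ρ(-tv).
        · have h1 := h.add_le (t • v) ((-t) • v)
          rw [← add_smul, add_neg_cancel, zero_smul, h.map_zero,
            h.pos_homogeneous (-t) v (by linarith)] at h1
          linarith)
    refine ⟨g, ?_, hg⟩
    have h1 := hgv ⟨v, Submodule.mem_span_singleton_self v⟩
    exact h1.trans (LinearPMap.mkSpanSingleton_apply ℝ ℝ hv _)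

end Risk

/-! ### Dual representation and the distortion bound. -/

section RiskMapping
variable {n : ℕ} {σ : Fin n → (Fin n → ℝ) → (Fin n → ℝ) → ℝ}

/-- The coefficients of a functional supporting the risk at `v` form a probability vector:
monotonicity makes them nonnegative, and translation equivariance, applied to 1 and -1, makes their
sum one. -/
theorem exists_mem_riskMultikernel_dotProduct_eq {i : Fin n} {p : Fin n → ℝ}
    (h : IsCoherentRisk (σ i p)) (v : Fin n → ℝ) :
    ∃ μ ∈ riskMultikernel σ i p, μ ⬝ᵥ v = σ i p v := by
  obtain ⟨g, hgv, hg⟩ := h.exists_linear_le v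
  have hdot : ∀ w, (fun j => g (Pi.single j 1)) ⬝ᵥ w = g w := fun w => by
    rw [LinearMap.pi_apply_eq_sum_univ g w]
    simp only [dotProduct, smul_eq_mul]
    exact Finset.sum_congr rfl fun j _ => by
      rw [mul_comm]; congr 2; ext k; simp [Pi.single_apply, eq_comm]
  refine ⟨fun j => g (Pi.single j 1), ⟨⟨fun j => ?_, ?_⟩, fun w => ?_⟩, ?_⟩
  · have h1 := hg (-Pi.single j 1)
    have h2 := h.monotone (-Pi.single j 1) 0 (by
      rw [neg_nonpos]; exact Pi.single_nonneg.2 zero_le_one)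
    rw [h.map_zero] at h2
    rw [map_neg] at h1
    linarith
  · have hone := hdot 1
    simp only [dotProduct_one] at hone
    have hc : ∀ b : ℝ, σ i p (fun _ => b) = b := fun b => by
      have := h.translation 0 b
      rwa [h.map_zero, zero_add, zero_add] at this
    have h1 : g 1 ≤ 1 := (hg 1).trans (hc 1).le
    have h2 : g (-1) ≤ -1 := (hg (-1)).trans (hc (-1)).le
    rw [map_neg] at h2
    rw [hone]; linarith
  · rw [hdot]; exact hg w
  · rw [hdot, hgv]

/-- Boundedness is what makes the real `sSup` in `distortionCoeff` an upper bound of its set rather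
than the default value 0. -/
theorem bddAbove_distortion (P : Matrix (Fin n) (Fin n) ℝ) (hP : P ∈ rowStochastic ℝ (Fin n)) :
    BddAbove {x : ℝ | ∃ i j, ∃ μ ∈ riskMultikernel σ i (P i), 0 < P i j ∧
      x = |μ j - P i j| / P i j} := by
  refine ⟨∑ i, ∑ j, |1 / P i j|, ?_⟩
  rintro x ⟨i, j, μ, ⟨⟨hμ0, hμ1⟩, -⟩, hpos, rfl⟩
  have h1 : |μ j - P i j| ≤ 1 := by
    have h2 : μ j ≤ 1 := hμ1 ▸ Finset.single_le_sum (fun k _ => hμ0 k) (Finset.mem_univ j)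
    have h3 := le_one_of_mem_rowStochastic hP (i := i) (j := j)
    have := hμ0 j
    rw [abs_le]; constructor <;> linarith
  calc |μ j - P i j| / P i j ≤ |1 / P i j| := by
        rw [abs_of_pos (one_div_pos.2 hpos)]
        exact div_le_div_of_nonneg_right h1 hpos.le
    _ ≤ ∑ j, |1 / P i j| := Finset.single_le_sum (f := fun j => |1 / P i j|)
        (fun k _ => abs_nonneg _) (Finset.mem_univ j)
    _ ≤ _ := Finset.single_le_sum (f := fun i => ∑ j, |1 / P i j|)
        (fun k _ => Finset.sum_nonneg fun _ _ => abs_nonneg _) (Finset.mem_univ i)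

theorem distortionCoeff_nonneg (P : Matrix (Fin n) (Fin n) ℝ) : 0 ≤ distortionCoeff σ P := by
  refine Real.sSup_nonneg ?_
  rintro x ⟨i, j, μ, -, hpos, rfl⟩
  positivity

/-- In this product form the bound also covers the entries with P i j = 0, where absolute continuity
makes both sides vanish. -/
theorem abs_sub_le_distortionCoeff_mul {P : Matrix (Fin n) (Fin n) ℝ}
    (hP : P ∈ rowStochastic ℝ (Fin n))
    (hac : ∀ i, ∀ μ ∈ riskMultikernel σ i (P i), ∀ j, P i j = 0 → μ j = 0)
    {i : Fin n} {μ : Fin n → ℝ} (hμ : μ ∈ riskMultikernel σ i (P i)) (j : Fin n) :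
    |μ j - P i j| ≤ distortionCoeff σ P * P i j := by
  rcases (nonneg_of_mem_rowStochastic hP (i := i) (j := j)).eq_or_lt with h | h
  · rw [← h, hac i μ hμ j h.symm]; simp
  · rw [← div_le_iff₀ h]
    exact le_csSup (bddAbove_distortion P hP) ⟨i, j, μ, hμ, h, rfl⟩

/-- Increments of the discounted risk deviate from those of `β P` by at most
`(α (1 + ϰ) - β) P |·|`. -/
theorem abs_risk_sub_le {P : Matrix (Fin n) (Fin n) ℝ}
    (hP : P ∈ rowStochastic ℝ (Fin n)) (hσ : IsTransitionRiskMapping σ)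
    (hac : ∀ i, ∀ μ ∈ riskMultikernel σ i (P i), ∀ j, P i j = 0 → μ j = 0)
    {α β : ℝ} (hα : 0 ≤ α) (hβ : β ≤ α) (v w : Fin n → ℝ) (i : Fin n) :
    |α * (riskOperator σ P v i - riskOperator σ P w i) - β * (P *ᵥ (v - w)) i| ≤
      (α * (1 + distortionCoeff σ P) - β) * (P *ᵥ |v - w|) i := by
  have hPi : P i ∈ stdSimplex ℝ (Fin n) :=
    ⟨fun j => nonneg_of_mem_rowStochastic hP, sum_row_of_mem_rowStochastic hP i⟩
  have key : ∀ v w : Fin n → ℝ,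
      α * (riskOperator σ P v i - riskOperator σ P w i) - β * (P *ᵥ (v - w)) i ≤
      (α * (1 + distortionCoeff σ P) - β) * (P *ᵥ |v - w|) i := by
    intro v w
    -- The measure attaining the risk at `v` is only admissible at `w`, so it bounds the increment
    -- from above. The lower bound follows by exchanging `v` and `w`.
    obtain ⟨μ, hμ, hμv⟩ := exists_mem_riskMultikernel_dotProduct_eq (hσ i _ hPi) v
    have h1 := hμ.2 w
    have h2 : riskOperator σ P v i - riskOperator σ P w i ≤ μ ⬝ᵥ (v - w) := by
      rw [dotProduct_sub, hμv]
      simp only [riskOperator]; linarith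
    have h3 : α * (μ ⬝ᵥ (v - w)) - β * (P *ᵥ (v - w)) i ≤
        (α * (1 + distortionCoeff σ P) - β) * (P *ᵥ |v - w|) i := by
      simp only [mulVec, dotProduct, Finset.mul_sum]
      rw [← Finset.sum_sub_distrib]
      refine Finset.sum_le_sum fun j _ => ?_
      have h4 := abs_sub_le_distortionCoeff_mul hP hac hμ j
      have h5 : |α * μ j - β * P i j| ≤ (α * (1 + distortionCoeff σ P) - β) * P i j := by
        -- Because β ≤ α, both summands contribute nonnegative bounds, αϰ P and (α - β) P.
        have h6 : α * μ j - β * P i j = α * (μ j - P i j) + (α - β) * P i j := by ring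
        rw [h6]
        refine (abs_add_le _ _).trans ?_
        rw [abs_mul, abs_mul, abs_of_nonneg hα, abs_of_nonneg (sub_nonneg.2 hβ),
          abs_of_nonneg (nonneg_of_mem_rowStochastic hP)]
        nlinarith [mul_le_mul_of_nonneg_left h4 hα]
      calc α * (μ j * (v - w) j) - β * (P i j * (v - w) j)
          = (α * μ j - β * P i j) * (v - w) j := by ring
        _ ≤ |α * μ j - β * P i j| * |(v - w) j| := by rw [← abs_mul]; exact le_abs_self _
        _ ≤ ((α * (1 + distortionCoeff σ P) - β) * P i j) * |(v - w) j| :=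
            mul_le_mul_of_nonneg_right h5 (abs_nonneg _)
        _ = _ := by rw [Pi.abs_apply]; ring
    nlinarith [mul_le_mul_of_nonneg_left h2 hα]
  rw [abs_le]
  have h1 := key v w
  have h2 := key w v
  rw [← neg_sub v w, mulVec_neg, abs_neg, Pi.neg_apply] at h2
  constructor <;> linarith

end RiskMapping

/-! ### The stationary law, the maximum principle and the Poisson equation. -/

section Stationary
variable {n : ℕ} {P : Matrix (Fin n) (Fin n) ℝ} {q : Fin n → ℝ}

/-- Some state carries mass, and by irreducibility a power of P, under which q is invariant, moves
part of it to `j`. -/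
theorem IsStationaryLaw.pos (hq : IsStationaryLaw P q) (hPirr : P.IsIrreducible) (j : Fin n) :
    0 < q j := by
  refine (hq.1.1 j).lt_of_ne' fun hj => ?_
  obtain ⟨i, hi⟩ : ∃ i, 0 < q i := by
    by_contra! h
    have h1 := hq.1.2
    rw [Finset.sum_eq_zero fun i _ => le_antisymm (h i) (hq.1.1 i)] at h1
    exact zero_ne_one h1
  obtain ⟨k, -, hk⟩ := (isIrreducible_iff_exists_pow_pos hPirr.nonneg).1 hPirr i j
  have hqk : ∀ k : ℕ, q ᵥ* P ^ k = q := by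
    intro k
    induction k with
    | zero => simp
    | succ k ih => rw [pow_succ, ← vecMul_vecMul, ih, hq.2]
  have h1 := congrFun (hqk k) j
  rw [hj] at h1
  simp only [vecMul, dotProduct] at h1
  have h2 := (Finset.sum_eq_zero_iff_of_nonneg fun l _ =>
    mul_nonneg (hq.1.1 l) (pow_apply_nonneg hPirr.nonneg k l j)).1 h1 i (Finset.mem_univ i)
  exact (mul_pos hi hk).ne' h2

theorem mulVec_sq_le (hP : P ∈ rowStochastic ℝ (Fin n)) (v : Fin n → ℝ) (i : Fin n) :
    (P *ᵥ v) i ^ 2 ≤ (P *ᵥ v ^ 2) i := by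
  have h := (even_two.convexOn_pow (𝕜 := ℝ)).map_sum_le (t := Finset.univ) (w := P i) (p := v)
    (fun j _ => nonneg_of_mem_rowStochastic hP) (sum_row_of_mem_rowStochastic hP i)
    (fun _ _ => Set.mem_univ _)
  exact h

theorem sum_mul_mulVec (hq : IsStationaryLaw P q) (v : Fin n → ℝ) :
    ∑ i, q i * (P *ᵥ v) i = ∑ i, q i * v i := by
  have := dotProduct_mulVec q P v
  rw [hq.2] at this
  exact this

/-- A stochastic matrix is nonexpansive in the mean square of its stationary law. -/
theorem sum_mul_mulVec_sq_le (hP : P ∈ rowStochastic ℝ (Fin n)) (hq : IsStationaryLaw P q)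
    (v : Fin n → ℝ) : ∑ i, q i * (P *ᵥ v) i ^ 2 ≤ ∑ i, q i * v i ^ 2 := by
  refine (Finset.sum_le_sum fun i _ => mul_le_mul_of_nonneg_left (mulVec_sq_le hP v i)
    (hq.1.1 i)).trans_eq (sum_mul_mulVec hq (v ^ 2))

/-- A vector fixed by an irreducible stochastic matrix is constant. -/
theorem eq_of_mulVec_eq_self (hP : P ∈ rowStochastic ℝ (Fin n)) (hPirr : P.IsIrreducible)
    {v : Fin n → ℝ} (hv : P *ᵥ v = v) (i j : Fin n) : v i = v j := by
  have hpow : ∀ k : ℕ, P ^ k *ᵥ v = v := by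
    intro k
    induction k with
    | zero => simp
    | succ k ih => rw [pow_succ, ← mulVec_mulVec, hv, ih]
  have : Nonempty (Fin n) := ⟨i⟩
  -- Maximum principle: an average with positive weights over reachable states equals the maximum
  -- only if all the values do.
  obtain ⟨i₀, hi₀⟩ := Finite.exists_max v
  have key : ∀ l, v l = v i₀ := by
    intro l
    obtain ⟨k, -, hk⟩ := (isIrreducible_iff_exists_pow_pos hPirr.nonneg).1 hPirr i₀ l
    have hPk : P ^ k ∈ rowStochastic ℝ (Fin n) := pow_mem hP k
    have h1 : ∑ l, (P ^ k) i₀ l * (v i₀ - v l) = 0 := by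
      have := congrFun (hpow k) i₀
      simp only [mulVec, dotProduct] at this
      simp only [mul_sub, Finset.sum_sub_distrib, ← Finset.sum_mul,
        sum_row_of_mem_rowStochastic hPk, this]
      ring
    have h2 := (Finset.sum_eq_zero_iff_of_nonneg fun l _ =>
      mul_nonneg (nonneg_of_mem_rowStochastic hPk) (sub_nonneg.2 (hi₀ l))).1 h1 l
      (Finset.mem_univ l)
    rcases mul_eq_zero.1 h2 with h | h
    · exact absurd h hk.ne'
    · linarith
  rw [key i, key j]

/-- The Poisson equation of an irreducible chain is solvable. -/
theorem exists_poisson_matrix (hP : P ∈ rowStochastic ℝ (Fin n)) (hPirr : P.IsIrreducible)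
    (hq : IsStationaryLaw P q) :
    ∃ Z : Matrix (Fin n) (Fin n) ℝ, (1 - P) * Z = 1 - Matrix.of fun _ j => q j := by
  set J : Matrix (Fin n) (Fin n) ℝ := Matrix.of fun _ j => q j
  have hJP : J * P = J := by
    ext i j
    exact congrFun hq.2 j
  have hJv : ∀ v i, (J *ᵥ v) i = q ⬝ᵥ v := fun v i => rfl
  have hJJ : J * J = J := by
    ext i j
    simp [J, mul_apply, ← Finset.sum_mul, hq.1.2]
  -- Adding the rank-one stationary projection removes the kernel of 1 - P: if Mv = 0, applying J
  -- gives Jv = 0, so Pv = v, and v is constant with q-mean zero.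
  set M := 1 - P + J
  have hM : IsUnit M.det := by
    rw [isUnit_iff_ne_zero]
    intro h0
    obtain ⟨v, hv0, hv⟩ := exists_mulVec_eq_zero_iff.2 h0
    have h1 : M *ᵥ v = v - P *ᵥ v + J *ᵥ v := by
      simp [M, add_mulVec, sub_mulVec]
    rw [h1] at hv
    have h2 : J *ᵥ v = 0 := by
      have h3 : J *ᵥ (v - P *ᵥ v + J *ᵥ v) = J *ᵥ v := by
        rw [mulVec_add, mulVec_sub, mulVec_mulVec, mulVec_mulVec, hJP, hJJ]; simp
      rw [hv, mulVec_zero] at h3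
      exact h3.symm
    rw [h2, add_zero, sub_eq_zero] at hv
    apply hv0
    ext i
    have h4 := congrFun h2 i
    rw [hJv] at h4
    simp only [dotProduct] at h4
    rw [Finset.sum_congr rfl fun j _ => by rw [eq_of_mulVec_eq_self hP hPirr hv.symm j i],
      ← Finset.sum_mul, hq.1.2, one_mul] at h4
    exact h4
  refine ⟨M⁻¹, ?_⟩
  have h1 : M * M⁻¹ = 1 := mul_nonsing_inv M hM
  have h2 : J * M = J := by
    simp [M, mul_add, mul_sub, hJP, hJJ]
  have h3 : J * M⁻¹ = J := by
    calc J * M⁻¹ = (J * M) * M⁻¹ := by rw [h2]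
      _ = J := by rw [Matrix.mul_assoc, h1, Matrix.mul_one]
  calc (1 - P) * M⁻¹ = (M - J) * M⁻¹ := by simp [M]
    _ = 1 - J := by rw [sub_mul, h1, h3]

end Stationary

/-! ### The resolvent and its norm in the stationary mean square. -/

section Resolvent
variable {n : ℕ} {P : Matrix (Fin n) (Fin n) ℝ} {q : Fin n → ℝ} {β : ℝ}

/-- The resolvent `∑ β^ℓ P^ℓ`. -/
noncomputable def resolventMatrix (β : ℝ) (P : Matrix (Fin n) (Fin n) ℝ) :
    Matrix (Fin n) (Fin n) ℝ :=
  ∑' ℓ : ℕ, β ^ ℓ • P ^ ℓ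

theorem summable_resolvent (hP : P ∈ rowStochastic ℝ (Fin n)) (hβ0 : 0 ≤ β) (hβ1 : β < 1) :
    Summable fun ℓ : ℕ => β ^ ℓ • P ^ ℓ := by
  refine Pi.summable.2 fun i => Pi.summable.2 fun j => ?_
  refine Summable.of_nonneg_of_le (fun ℓ => ?_) (fun ℓ => ?_) (summable_geometric_of_lt_one hβ0 hβ1)
  · exact mul_nonneg (pow_nonneg hβ0 ℓ) (nonneg_of_mem_rowStochastic (pow_mem hP ℓ))
  · exact mul_le_of_le_one_right (pow_nonneg hβ0 ℓ) (le_one_of_mem_rowStochastic (pow_mem hP ℓ))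

theorem resolventMatrix_eq_one_add_mul (hP : P ∈ rowStochastic ℝ (Fin n)) (hβ0 : 0 ≤ β)
    (hβ1 : β < 1) : resolventMatrix β P = 1 + β • (P * resolventMatrix β P) := by
  have hs := summable_resolvent hP hβ0 hβ1
  rw [resolventMatrix]
  conv_lhs => rw [hs.tsum_eq_zero_add]
  rw [pow_zero, pow_zero, one_smul]
  congr 1
  rw [← hs.tsum_mul_left, ← (hs.mul_left P).tsum_const_smul]
  refine tsum_congr fun ℓ => ?_
  rw [pow_succ', pow_succ', mul_smul_comm, smul_smul]

theorem one_sub_mul_resolventMatrix (hP : P ∈ rowStochastic ℝ (Fin n)) (hβ0 : 0 ≤ β)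
    (hβ1 : β < 1) : (1 - β • P) * resolventMatrix β P = 1 := by
  have := resolventMatrix_eq_one_add_mul hP hβ0 hβ1
  rw [sub_mul, one_mul, smul_mul_assoc, sub_eq_iff_eq_add]
  exact this

theorem resolventMatrix_mulVec (hP : P ∈ rowStochastic ℝ (Fin n)) (hβ0 : 0 ≤ β)
    (hβ1 : β < 1) (v : Fin n → ℝ) :
    resolventMatrix β P *ᵥ v = v + β • P *ᵥ (resolventMatrix β P *ᵥ v) := by
  conv_lhs => rw [resolventMatrix_eq_one_add_mul hP hβ0 hβ1]
  rw [add_mulVec, one_mulVec, smul_mulVec, mulVec_mulVec]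

/-- Here the resolvent stands outside βP, which allows the part βPu of a risk increment to be split
off inside it. -/
theorem resolventMatrix_mulVec' (hP : P ∈ rowStochastic ℝ (Fin n)) (hβ0 : 0 ≤ β)
    (hβ1 : β < 1) (v : Fin n → ℝ) :
    resolventMatrix β P *ᵥ v = v + resolventMatrix β P *ᵥ (β • P *ᵥ v) := by
  have h1 := mul_eq_one_comm.1 (one_sub_mul_resolventMatrix hP hβ0 hβ1)
  have h2 : (resolventMatrix β P * (1 - β • P)) *ᵥ v = v := by rw [h1, one_mulVec]
  rw [← mulVec_mulVec, sub_mulVec, one_mulVec, mulVec_sub, sub_eq_iff_eq_add, smul_mulVec] at h2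
  exact h2

/-- The resolvent has norm at most `1 / (1 - β)` in the mean square of the stationary law. -/
theorem sum_mul_resolventMatrix_sq_le (hP : P ∈ rowStochastic ℝ (Fin n)) (hq : IsStationaryLaw P q)
    (hβ0 : 0 ≤ β) (hβ1 : β < 1) (v : Fin n → ℝ) :
    (1 - β) ^ 2 * ∑ i, q i * (resolventMatrix β P *ᵥ v) i ^ 2 ≤ ∑ i, q i * v i ^ 2 := by
  set x := resolventMatrix β P *ᵥ v
  have hx : ∀ i, x i = v i + β * (P *ᵥ x) i := fun i =>
    congrFun (resolventMatrix_mulVec hP hβ0 hβ1 v) i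
  -- Convexity of the square for x = (1 - β) · v/(1 - β) + β · Px, multiplied by 1 - β.
  have h1 : ∀ i, (1 - β) * x i ^ 2 ≤ v i ^ 2 + (1 - β) * (β * (P *ᵥ x) i ^ 2) := by
    intro i
    rw [hx i]
    nlinarith [mul_nonneg hβ0 (sq_nonneg (v i - (1 - β) * (P *ᵥ x) i))]
  have h2 : (1 - β) * ∑ i, q i * x i ^ 2 ≤ ∑ i, q i * v i ^ 2 +
      (1 - β) * (β * ∑ i, q i * (P *ᵥ x) i ^ 2) := by
    simp only [Finset.mul_sum]
    rw [← Finset.sum_add_distrib]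
    refine Finset.sum_le_sum fun i _ => ?_
    nlinarith [mul_le_mul_of_nonneg_left (h1 i) (hq.1.1 i)]
  have h3 := sum_mul_mulVec_sq_le hP hq x
  have h4 := mul_le_mul_of_nonneg_left h3 (mul_nonneg (sub_nonneg.2 hβ1.le) hβ0)
  nlinarith

end Resolvent

/-! ### The mean field: monotonicity, Lipschitz bound and zeros. -/

section Field
variable {n m : ℕ} {σ : Fin n → (Fin n → ℝ) → (Fin n → ℝ) → ℝ}

/-- The temporal difference of the states at the weights `r`. -/
def temporalDifference (σ : Fin n → (Fin n → ℝ) → (Fin n → ℝ) → ℝ) (P : Matrix (Fin n) (Fin n) ℝ)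
    (c : Fin n → ℝ) (Φ : Matrix (Fin n) (Fin m) ℝ) (α : ℝ) (r : Fin m → ℝ) : Fin n → ℝ :=
  Φ *ᵥ r - c - α • riskOperator σ P (Φ *ᵥ r)

/-- The mean field of the method when the temporal differences of the states are `g`. -/
noncomputable def meanField (P : Matrix (Fin n) (Fin n) ℝ) (q : Fin n → ℝ)
    (Φ : Matrix (Fin n) (Fin m) ℝ) (β : ℝ) (g : Fin n → ℝ) : Fin m → ℝ :=
  Φᵀ *ᵥ (q * (resolventMatrix β P *ᵥ g))

theorem dotProduct_meanField (P : Matrix (Fin n) (Fin n) ℝ) (q : Fin n → ℝ)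
    (Φ : Matrix (Fin n) (Fin m) ℝ) (β : ℝ) (g : Fin n → ℝ) (s : Fin m → ℝ) :
    s ⬝ᵥ meanField P q Φ β g = ∑ i, q i * ((Φ *ᵥ s) i * (resolventMatrix β P *ᵥ g) i) := by
  rw [meanField, dotProduct_mulVec, vecMul_transpose]
  simp only [dotProduct, Pi.mul_apply]
  exact Finset.sum_congr rfl fun i _ => by ring

/-- Strong monotonicity of the mean field. -/
theorem exists_strongMonotone_meanField {P : Matrix (Fin n) (Fin n) ℝ}
    (hP : P ∈ rowStochastic ℝ (Fin n)) {q : Fin n → ℝ} (hq : IsStationaryLaw P q)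
    (hσ : IsTransitionRiskMapping σ)
    (hac : ∀ i, ∀ μ ∈ riskMultikernel σ i (P i), ∀ j, P i j = 0 → μ j = 0)
    (c : Fin n → ℝ) (Φ : Matrix (Fin n) (Fin m) ℝ)
    {α β : ℝ} (hβ0 : 0 ≤ β) (hβα : β ≤ α)
    (hcontr : α * (1 + distortionCoeff σ P) < 1) :
    ∃ κ > 0, ∀ r s : Fin m → ℝ, κ * ∑ i, q i * (Φ *ᵥ (r - s)) i ^ 2 ≤
      (r - s) ⬝ᵥ (meanField P q Φ β (temporalDifference σ P c Φ α r) -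
        meanField P q Φ β (temporalDifference σ P c Φ α s)) := by
  have hα := hβ0.trans hβα
  have hd := distortionCoeff_nonneg (σ := σ) P
  set δ := α * (1 + distortionCoeff σ P) - β
  have hδ0 : 0 ≤ δ := by simp only [δ]; nlinarith [mul_nonneg hα hd]
  have hβ1 : β < 1 := by simp only [δ] at hδ0; linarith
  have hδ1 : δ < 1 - β := by simp only [δ]; linarith
  have hb : 0 < 1 - β := by linarith
  set ρ := δ / (1 - β)
  have hρ0 : 0 ≤ ρ := by positivity
  have hρ1 : ρ < 1 := (div_lt_one hb).2 hδ1
  refine ⟨(1 - ρ ^ 2) / 2, by nlinarith, fun r s => ?_⟩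
  set u := Φ *ᵥ (r - s)
  have hu : u = Φ *ᵥ r - Φ *ᵥ s := mulVec_sub _ _ _
  set w := riskOperator σ P (Φ *ᵥ r) - riskOperator σ P (Φ *ᵥ s)
  -- The resolvent maps u - αw to u + Rk, so `k` is the only obstacle to positivity.
  set k : Fin n → ℝ := β • P *ᵥ u - α • w
  have hk : ∀ i, k i ^ 2 ≤ δ ^ 2 * (P *ᵥ |u|) i ^ 2 := by
    intro i
    have h1 := abs_risk_sub_le hP hσ hac hα hβα (Φ *ᵥ r) (Φ *ᵥ s) i
    rw [← hu] at h1
    rw [← mul_pow, ← sq_abs (k i)]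
    refine pow_le_pow_left₀ (abs_nonneg _) (le_of_eq_of_le ?_ h1) 2
    rw [abs_sub_comm]
    rfl
  have hNk : ∑ i, q i * k i ^ 2 ≤ δ ^ 2 * ∑ i, q i * u i ^ 2 := by
    have h1 := sum_mul_mulVec_sq_le hP hq |u|
    simp only [Pi.abs_apply, sq_abs] at h1
    refine le_trans ?_ (mul_le_mul_of_nonneg_left h1 (sq_nonneg δ))
    rw [Finset.mul_sum]
    refine Finset.sum_le_sum fun i _ => ?_
    have := mul_le_mul_of_nonneg_left (hk i) (hq.1.1 i)
    linarith
  have hNRk : ∑ i, q i * (resolventMatrix β P *ᵥ k) i ^ 2 ≤ ρ ^ 2 * ∑ i, q i * u i ^ 2 := by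
    have h1 := (sum_mul_resolventMatrix_sq_le hP hq hβ0 hβ1 k).trans hNk
    simp only [ρ]
    rw [div_pow, div_mul_eq_mul_div, le_div_iff₀ (by positivity)]
    linarith
  have hg : temporalDifference σ P c Φ α r - temporalDifference σ P c Φ α s = u - α • w := by
    simp only [temporalDifference, w, hu, smul_sub]
    abel
  have hRg : resolventMatrix β P *ᵥ (u - α • w) = u + resolventMatrix β P *ᵥ k := by
    rw [mulVec_sub, resolventMatrix_mulVec' hP hβ0 hβ1 u]
    simp only [k, mulVec_sub]
    abel
  have hm : meanField P q Φ β (temporalDifference σ P c Φ α r) -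
        meanField P q Φ β (temporalDifference σ P c Φ α s) = meanField P q Φ β (u - α • w) := by
    rw [← hg]
    simp only [meanField, ← mulVec_sub, ← mul_sub]
  rw [hm, dotProduct_meanField, hRg]
  -- The difference of the two brackets is half of (u + Rk)². Together with ‖Rk‖ ≤ ρ‖u‖ this yields
  -- the constant (1 - ρ²)/2.
  have h5 : ∀ i, q i * (u i ^ 2 / 2 - (resolventMatrix β P *ᵥ k) i ^ 2 / 2) ≤
      q i * (u i * (u + resolventMatrix β P *ᵥ k) i) := by
    intro i
    refine mul_le_mul_of_nonneg_left ?_ (hq.1.1 i)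
    rw [Pi.add_apply]
    nlinarith [sq_nonneg (u i + (resolventMatrix β P *ᵥ k) i)]
  refine le_trans ?_ (Finset.sum_le_sum fun i _ => h5 i)
  simp only [mul_sub, Finset.sum_sub_distrib, ← mul_div_assoc, ← Finset.sum_div]
  linarith

theorem norm_temporalDifference_sub_le {P : Matrix (Fin n) (Fin n) ℝ}
    (hP : P ∈ rowStochastic ℝ (Fin n)) (hσ : IsTransitionRiskMapping σ)
    (c : Fin n → ℝ) (Φ : Matrix (Fin n) (Fin m) ℝ) (α : ℝ) (r s : Fin m → ℝ) :
    ‖temporalDifference σ P c Φ α r - temporalDifference σ P c Φ α s‖ ≤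
      (1 + |α|) * ‖Φ *ᵥ (r - s)‖ := by
  refine (pi_norm_le_iff_of_nonneg (by positivity)).2 fun i => ?_
  have hPi : P i ∈ stdSimplex ℝ (Fin n) :=
    ⟨fun j => nonneg_of_mem_rowStochastic hP, sum_row_of_mem_rowStochastic hP i⟩
  have h1 := (hσ i _ hPi).abs_sub_le (Φ *ᵥ r) (Φ *ᵥ s)
  have h2 := norm_le_pi_norm (Φ *ᵥ r - Φ *ᵥ s) i
  rw [mulVec_sub]
  have h3 : (temporalDifference σ P c Φ α r - temporalDifference σ P c Φ α s) i =
      (Φ *ᵥ r - Φ *ᵥ s) i - α * (σ i (P i) (Φ *ᵥ r) - σ i (P i) (Φ *ᵥ s)) := by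
    simp [temporalDifference, riskOperator]; ring
  rw [h3]
  refine (norm_sub_le _ _).trans ?_
  rw [norm_mul, Real.norm_eq_abs α, Real.norm_eq_abs (σ i _ _ - _)]
  nlinarith [mul_le_mul_of_nonneg_left h1 (abs_nonneg α)]

/-- Zeros of the mean field solve the projected multistep equation. -/
theorem solves_of_meanField_eq_zero {P : Matrix (Fin n) (Fin n) ℝ} {q : Fin n → ℝ}
    (hq : ∀ i, 0 ≤ q i) {c : Fin n → ℝ} {Φ : Matrix (Fin n) (Fin m) ℝ} {α lam : ℝ}
    {r : Fin m → ℝ}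
    (h : meanField P q Φ (lam * α) (temporalDifference σ P c Φ α r) = 0) :
    SolvesProjectedMultistepEquation σ P q c Φ α lam r := by
  set β := lam * α
  set a := multistepMatrix β P *ᵥ (Φ *ᵥ r)
  set b := multistepMatrix β P *ᵥ (c + α • riskOperator σ P (Φ *ᵥ r))
  have hab : a - b = (1 - β) • resolventMatrix β P *ᵥ temporalDifference σ P c Φ α r := by
    simp only [a, b, temporalDifference, multistepMatrix, ← mulVec_sub]
    rw [smul_mulVec, sub_add_eq_sub_sub]
    rfl
  -- A vanishing mean field says that a - b is q-orthogonal to range Φ. Squared distances from range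
  -- points to `a` and to `b` then differ by a constant, so the same points minimize both.
  have horth : ∀ s, ∑ i, q i * ((Φ *ᵥ s) i * (a - b) i) = 0 := by
    intro s
    have h1 := dotProduct_meanField P q Φ β (temporalDifference σ P c Φ α r) s
    rw [h, dotProduct_zero] at h1
    rw [hab, ← mul_zero (1 - β), h1, Finset.mul_sum]
    refine Finset.sum_congr rfl fun i _ => ?_
    simp only [Pi.smul_apply, smul_eq_mul]; ring
  have hsq : ∀ s, ∑ i, q i * (Φ *ᵥ s - a) i ^ 2 = ∑ i, q i * (Φ *ᵥ s - b) i ^ 2 +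
      ∑ i, q i * (a i ^ 2 - b i ^ 2) := by
    intro s
    have h1 := horth s
    rw [← Finset.sum_add_distrib, ← sub_eq_zero, ← Finset.sum_sub_distrib, ← mul_zero (-2 : ℝ), ← h1,
      Finset.mul_sum]
    refine Finset.sum_congr rfl fun i _ => ?_
    simp only [Pi.sub_apply]; ring
  have hiff : ∀ s t, qNorm q (Φ *ᵥ s - a) ≤ qNorm q (Φ *ᵥ t - a) ↔
      qNorm q (Φ *ᵥ s - b) ≤ qNorm q (Φ *ᵥ t - b) := by
    have hnn : ∀ v : Fin n → ℝ, 0 ≤ ∑ i, q i * v i ^ 2 := fun v =>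
      Finset.sum_nonneg fun i _ => mul_nonneg (hq i) (sq_nonneg _)
    intro s t
    rw [qNorm, qNorm, qNorm, qNorm, Real.sqrt_le_sqrt_iff (hnn _), Real.sqrt_le_sqrt_iff (hnn _),
      hsq, hsq, add_le_add_iff_right]
  -- The two predicates coincide, so `Classical.epsilon` selects the same point; uniqueness of the
  -- projection plays no role.
  have hpred : IsQProjection q Φ a = IsQProjection q Φ b := by
    ext z
    refine and_congr_right ?_
    rintro ⟨s, rfl⟩
    exact forall_congr' fun t => hiff s t
  change Classical.epsilon (IsQProjection q Φ a) = Classical.epsilon (IsQProjection q Φ b)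
  rw [hpred]

end Field

/-! ### Convergence of square integrable martingale series. -/

section Martingale
variable {Ω : Type*} {m0 : MeasurableSpace Ω} {μ : Measure Ω} [IsProbabilityMeasure μ]
  {F : Filtration ℕ m0}

/-- A series of square integrable martingale differences with summable second moments converges. -/
theorem ae_exists_tendsto_sum_of_martingale_diff {Y : ℕ → Ω → ℝ}
    (hY : ∀ t, MemLp (Y t) 2 μ) (hadp : ∀ t, StronglyMeasurable[F (t + 1)] (Y t))
    (hmean : ∀ t, μ[Y t | F t] =ᵐ[μ] 0) (hsum : Summable fun t => ∫ ω, Y t ω ^ 2 ∂μ) :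
    ∀ᵐ ω ∂μ, ∃ l, Tendsto (fun T => ∑ t ∈ Finset.range T, Y t ω) atTop (𝓝 l) := by
  set M : ℕ → Ω → ℝ := fun T => ∑ t ∈ Finset.range T, Y t
  have hM2 : ∀ T, MemLp (M T) 2 μ := fun T => memLp_finsetSum' _ fun t _ => hY t
  have hMad : StronglyAdapted F M := fun T =>
    Finset.stronglyMeasurable_sum _ fun t ht =>
      (hadp t).mono (F.mono (Nat.succ_le_of_lt (Finset.mem_range.1 ht)))
  have hsucc : ∀ T, M (T + 1) = M T + Y T := fun T => Finset.sum_range_succ _ _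
  have hmart : Martingale M F μ := by
    refine martingale_of_condExp_sub_eq_zero_nat hMad
      (fun T => (hM2 T).integrable (by norm_num)) fun T => ?_
    rw [hsucc, add_sub_cancel_left]
    exact hmean T
  -- Orthogonality of increments makes the second moments of the partial sums additive.
  have hcross : ∀ T, ∫ ω, M T ω * Y T ω ∂μ = 0 := by
    intro T
    have hint : Integrable (M T * Y T) μ := (hM2 T).integrable_mul (hY T)
    have h1 : μ[M T * Y T | F T] =ᵐ[μ] M T * μ[Y T | F T] :=
      condExp_mul_of_stronglyMeasurable_left (hMad T) hint ((hY T).integrable (by norm_num))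
    have h2 : μ[M T * Y T | F T] =ᵐ[μ] 0 := by
      filter_upwards [h1, hmean T] with ω h h'
      rw [h, Pi.mul_apply, h']; simp
    change ∫ ω, (M T * Y T) ω ∂μ = 0
    rw [← integral_condExp (F.le T), integral_congr_ae h2]
    simp
  have hsq : ∀ T, ∫ ω, M T ω ^ 2 ∂μ = ∑ t ∈ Finset.range T, ∫ ω, Y t ω ^ 2 ∂μ := by
    intro T
    induction T with
    | zero => simp [M]
    | succ T ih =>
      rw [Finset.sum_range_succ, ← ih, hsucc]
      have h1 : ∀ ω, (M T + Y T) ω ^ 2 = M T ω ^ 2 + 2 * (M T ω * Y T ω) + Y T ω ^ 2 := by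
        intro ω; rw [Pi.add_apply]; ring
      have hi1 : Integrable (fun ω => M T ω ^ 2) μ := (hM2 T).integrable_sq
      have hi2 : Integrable (fun ω => 2 * (M T ω * Y T ω)) μ :=
        ((hM2 T).integrable_mul (hY T)).const_mul 2
      simp only [h1]
      rw [integral_add (f := fun ω => M T ω ^ 2 + 2 * (M T ω * Y T ω)) (hi1.add hi2)
        (hY T).integrable_sq, integral_add hi1 hi2, integral_const_mul, hcross]
      ring
  set C := ∑' t, ∫ ω, Y t ω ^ 2 ∂μ
  have hC : ∀ T, ∫ ω, M T ω ^ 2 ∂μ ≤ C := fun T => by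
    rw [hsq]
    exact hsum.sum_le_tsum _ fun t _ => integral_nonneg fun ω => sq_nonneg _
  have hbdd : ∀ T, eLpNorm (M T) 1 μ ≤ (Real.toNNReal (1 + C) : ENNReal) := by
    intro T
    rw [eLpNorm_one_eq_lintegral_enorm,
      ← ofReal_integral_norm_eq_lintegral_enorm ((hM2 T).integrable (by norm_num))]
    refine ENNReal.ofReal_le_ofReal ?_
    -- The inequality |x| ≤ 1 + x² turns the second moment bound into the first moment bound that
    -- martingale convergence requires.
    have h1 : ∫ ω, ‖M T ω‖ ∂μ ≤ ∫ ω, (1 + M T ω ^ 2) ∂μ := by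
      refine integral_mono ((hM2 T).integrable (by norm_num)).norm
        ((integrable_const _).add (hM2 T).integrable_sq) fun ω => ?_
      simp only [Real.norm_eq_abs]
      nlinarith [sq_nonneg (|M T ω| - 1), sq_abs (M T ω)]
    rw [integral_add (integrable_const _) (hM2 T).integrable_sq] at h1
    simp only [integral_const, probReal_univ, smul_eq_mul, mul_one] at h1
    linarith [hC T]
  filter_upwards [hmart.submartingale.exists_ae_tendsto_of_bdd hbdd] with ω ⟨l, hl⟩
  exact ⟨l, by simpa [M, Finset.sum_apply] using hl⟩

/-- Second moment of a bounded predictable multiple of a variable with bounded conditional second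
moment. -/
theorem memLp_mul_and_integral_sq_le {G : MeasurableSpace Ω} (hG : G ≤ m0) {a D : Ω → ℝ} {A K : ℝ}
    (ha : StronglyMeasurable[G] a) (haA : ∀ ω, |a ω| ≤ A) (hD : MemLp D 2 μ)
    (hvar : ∀ᵐ ω ∂μ, (μ[fun ω' => D ω' ^ 2 | G]) ω ≤ K) :
    MemLp (a * D) 2 μ ∧ ∫ ω, (a ω * D ω) ^ 2 ∂μ ≤ K * ∫ ω, a ω ^ 2 ∂μ := by
  have hbd : ∀ᵐ ω ∂μ, ‖a ω‖ ≤ A := Eventually.of_forall haA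
  have hmem : MemLp (a * D) 2 μ := by
    refine MemLp.of_le_mul (c := A) hD ((ha.mono hG).aestronglyMeasurable.mul hD.1) ?_
    filter_upwards [hbd] with ω h
    rw [Pi.mul_apply, norm_mul]
    exact mul_le_mul_of_nonneg_right h (norm_nonneg _)
  refine ⟨hmem, ?_⟩
  have hint : Integrable ((fun ω => a ω ^ 2) * fun ω => D ω ^ 2) μ := by
    have := hmem.integrable_sq
    refine this.congr (Eventually.of_forall fun ω => ?_)
    simp only [Pi.mul_apply]; ring
  have ha2 : StronglyMeasurable[G] fun ω => a ω ^ 2 := ha.pow 2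
  have h1 := condExp_mul_of_stronglyMeasurable_left ha2 hint hD.integrable_sq
  have ha2i : Integrable (fun ω => a ω ^ 2) μ := by
    have : MemLp a 2 μ := MemLp.of_bound (ha.mono hG).aestronglyMeasurable A hbd
    exact this.integrable_sq
  calc ∫ ω, (a ω * D ω) ^ 2 ∂μ = ∫ ω, ((fun ω => a ω ^ 2) * fun ω => D ω ^ 2) ω ∂μ := by
        congr 1; ext ω; simp only [Pi.mul_apply]; ring
    _ = ∫ ω, (μ[(fun ω => a ω ^ 2) * fun ω => D ω ^ 2 | G]) ω ∂μ := (integral_condExp hG).symm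
    _ ≤ ∫ ω, K * a ω ^ 2 ∂μ := by
        refine integral_mono_ae integrable_condExp (ha2i.const_mul K) ?_
        filter_upwards [h1, hvar] with ω h h'
        rw [h, Pi.mul_apply, mul_comm]
        exact mul_le_mul_of_nonneg_right h' (sq_nonneg _)
    _ = _ := integral_const_mul _ _

/-- Convergence of a series of noises with bounded conditional variance and square summable
predictable weights. -/
theorem ae_exists_tendsto_sum_mul_of_condVar_le {a D : ℕ → Ω → ℝ} {A K : ℝ}
    (ha : ∀ t, StronglyMeasurable[F t] (a t)) (haA : ∀ t ω, |a t ω| ≤ A)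
    (hasum : Summable fun t => ∫ ω, a t ω ^ 2 ∂μ)
    (hD : ∀ t, MemLp (D t) 2 μ) (hmean : ∀ t, μ[D t | F t] =ᵐ[μ] 0)
    (hvar : ∀ t, ∀ᵐ ω ∂μ, (μ[fun ω' => D t ω' ^ 2 | F t]) ω ≤ K)
    (hadp : ∀ t, StronglyMeasurable[F (t + 1)] fun ω => a t ω * D t ω) :
    ∀ᵐ ω ∂μ, ∃ l, Tendsto (fun T => ∑ t ∈ Finset.range T, a t ω * D t ω) atTop (𝓝 l) := by
  have h := fun t => memLp_mul_and_integral_sq_le (F.le t) (ha t) (haA t) (hD t) (hvar t)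
  refine ae_exists_tendsto_sum_of_martingale_diff (F := F) (Y := fun t ω => a t ω * D t ω)
    (fun t => (h t).1) hadp (fun t => ?_) ?_
  · have h1 := condExp_mul_of_stronglyMeasurable_left (ha t) ((h t).1.integrable (by norm_num))
      ((hD t).integrable (by norm_num))
    filter_upwards [h1, hmean t] with ω h h'
    have h2 : μ[fun ω => a t ω * D t ω | F t] ω = _ := h
    rw [h2, Pi.mul_apply, h']; simp
  · exact Summable.of_nonneg_of_le (fun t => integral_nonneg fun ω => sq_nonneg _)
      (fun t => (h t).2) (hasum.mul_left K)

/-- The squares of the weighted noises are summable. -/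
theorem ae_summable_sq_mul_of_condVar_le {a D : ℕ → Ω → ℝ} {A K : ℝ}
    (ha : ∀ t, StronglyMeasurable[F t] (a t)) (haA : ∀ t ω, |a t ω| ≤ A)
    (hasum : Summable fun t => ∫ ω, a t ω ^ 2 ∂μ)
    (hD : ∀ t, MemLp (D t) 2 μ)
    (hvar : ∀ t, ∀ᵐ ω ∂μ, (μ[fun ω' => D t ω' ^ 2 | F t]) ω ≤ K) :
    ∀ᵐ ω ∂μ, Summable fun t => (a t ω * D t ω) ^ 2 := by
  have h := fun t => memLp_mul_and_integral_sq_le (F.le t) (ha t) (haA t) (hD t) (hvar t)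
  have hs : Summable fun t => ∫ ω, (a t ω * D t ω) ^ 2 ∂μ :=
    Summable.of_nonneg_of_le (fun t => integral_nonneg fun ω => sq_nonneg _)
      (fun t => (h t).2) (hasum.mul_left K)
  have hi : ∀ t, Integrable (fun ω => (a t ω * D t ω) ^ 2) μ := fun t => (h t).1.integrable_sq
  have hfin : ∫⁻ ω, ∑' t, ENNReal.ofReal ((a t ω * D t ω) ^ 2) ∂μ ≠ ⊤ := by
    rw [lintegral_tsum fun t => (hi t).1.aemeasurable.ennreal_ofReal]
    have : ∀ t, ∫⁻ ω, ENNReal.ofReal ((a t ω * D t ω) ^ 2) ∂μ =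
        ENNReal.ofReal (∫ ω, (a t ω * D t ω) ^ 2 ∂μ) := fun t =>
      (ofReal_integral_eq_lintegral_ofReal (hi t) (Eventually.of_forall fun ω => sq_nonneg _)).symm
    simp only [this]
    exact hs.tsum_ofReal_ne_top
  have hae := ae_lt_top' (AEMeasurable.tsum fun t =>
    (hi t).1.aemeasurable.ennreal_ofReal) hfin
  filter_upwards [hae] with ω hω
  have := ENNReal.summable_toReal hω.ne
  refine this.congr fun t => ENNReal.toReal_ofReal (sq_nonneg _)

end Martingale

/-! ### A Poisson potential for the state and the eligibility trace. -/

section TracePotential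
variable {n m : ℕ}

/-- A potential of the state-trace chain: its expected decrement in a step is
`g i • z - meanField g`, see `tracePotential_sub_expected`. -/
noncomputable def tracePotential (P Z : Matrix (Fin n) (Fin n) ℝ) (Φ : Matrix (Fin n) (Fin m) ℝ)
    (β : ℝ) (z : Fin m → ℝ) (i : Fin n) (g : Fin n → ℝ) : Fin m → ℝ :=
  (resolventMatrix β P *ᵥ g) i • z + (P * Z * diagonal (resolventMatrix β P *ᵥ g) * Φ) i

/-- With G = Rg, the term G_i z has expected decrement g_i z - (P diag(G) Φ)_i, since G = g + βPG.
The second term cancels the remainder up to its stationary mean: by the Poisson equation its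
decrement is (P diag(G) Φ)_i minus the q-average of the rows of diag(G) Φ, which is the mean field.
-/
theorem tracePotential_sub_expected {P Z : Matrix (Fin n) (Fin n) ℝ}
    (hP : P ∈ rowStochastic ℝ (Fin n)) {q : Fin n → ℝ}
    (hZ : (1 - P) * Z = 1 - Matrix.of fun _ j => q j)
    (Φ : Matrix (Fin n) (Fin m) ℝ) {β : ℝ} (hβ0 : 0 ≤ β) (hβ1 : β < 1)
    (z : Fin m → ℝ) (i : Fin n) (g : Fin n → ℝ) :
    tracePotential P Z Φ β z i g - ∑ j, P i j • tracePotential P Z Φ β (β • z + Φ j) j g =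
      g i • z - meanField P q Φ β g := by
  set G := resolventMatrix β P *ᵥ g
  have hG : G i = g i + β * (P *ᵥ G) i := congrFun (resolventMatrix_mulVec hP hβ0 hβ1 g) i
  set U := P * Z * diagonal G * Φ
  have hPJ : P * (Matrix.of fun _ j => q j : Matrix (Fin n) (Fin n) ℝ) = Matrix.of fun _ j => q j := by
    ext a b
    simp [mul_apply, ← Finset.sum_mul, sum_row_of_mem_rowStochastic hP]
  have hU : U - P * U = P * (diagonal G * Φ) - (Matrix.of fun _ j => q j) * (diagonal G * Φ) := by
    have h1 : U - P * U = P * ((1 - P) * Z) * (diagonal G * Φ) := by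
      simp only [U, Matrix.mul_sub, Matrix.sub_mul, Matrix.one_mul, Matrix.mul_assoc]
    rw [h1, hZ, Matrix.mul_sub, Matrix.mul_one, hPJ, Matrix.sub_mul]
  ext k
  have hUk := congrFun (congrFun hU i) k
  simp only [Matrix.sub_apply] at hUk
  have h1 : (P * U) i k = ∑ j, P i j * U j k := mul_apply
  have h2 : (P * (diagonal G * Φ)) i k = ∑ j, P i j * (G j * Φ j k) := by
    rw [mul_apply]
    simp only [diagonal_mul]
  have h3 : ((Matrix.of fun _ j => q j : Matrix (Fin n) (Fin n) ℝ) * (diagonal G * Φ)) i k =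
      meanField P q Φ β g k := by
    rw [mul_apply]
    simp only [meanField, mulVec, dotProduct, diagonal_mul, of_apply, transpose_apply, Pi.mul_apply]
    exact Finset.sum_congr rfl fun j _ => by
      change q j * (G j * Φ j k) = Φ j k * (q j * G j)
      ring
  rw [h1, h2, h3] at hUk
  have h4 : (∑ j, P i j • tracePotential P Z Φ β (β • z + Φ j) j g) k =
      β * (P *ᵥ G) i * z k + ∑ j, P i j * (G j * Φ j k) + ∑ j, P i j * U j k := by
    simp only [Finset.sum_apply, mulVec, dotProduct]
    rw [Finset.mul_sum, Finset.sum_mul, ← Finset.sum_add_distrib, ← Finset.sum_add_distrib]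
    refine Finset.sum_congr rfl fun j _ => ?_
    simp only [tracePotential, Pi.smul_apply, Pi.add_apply, smul_eq_mul]
    change P i j * (G j * (β * z k + Φ j k) + U j k) = _
    ring
  simp only [Pi.sub_apply]
  rw [h4]
  simp only [tracePotential, Pi.smul_apply, Pi.add_apply, smul_eq_mul]
  change G i * z k + U i k - _ = _
  rw [hG]
  linarith

theorem tracePotential_sub (P Z : Matrix (Fin n) (Fin n) ℝ) (Φ : Matrix (Fin n) (Fin m) ℝ)
    (β : ℝ) (z : Fin m → ℝ) (i : Fin n) (g g' : Fin n → ℝ) :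
    tracePotential P Z Φ β z i (g - g') =
      tracePotential P Z Φ β z i g - tracePotential P Z Φ β z i g' := by
  have h : diagonal (resolventMatrix β P *ᵥ g - resolventMatrix β P *ᵥ g') =
      diagonal (resolventMatrix β P *ᵥ g) - diagonal (resolventMatrix β P *ᵥ g') :=
    (diagonal_sub _ _).symm
  simp only [tracePotential, mulVec_sub, h, Matrix.mul_sub, Matrix.sub_mul, Pi.sub_apply, sub_smul]
  rw [show ∀ A B : Matrix (Fin n) (Fin m) ℝ, (A - B) i = A i - B i from fun _ _ => rfl]
  abel

theorem exists_norm_tracePotential_le (P Z : Matrix (Fin n) (Fin n) ℝ)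
    (Φ : Matrix (Fin n) (Fin m) ℝ) (β : ℝ) :
    ∃ C ≥ 0, ∀ z i g, ‖tracePotential P Z Φ β z i g‖ ≤ C * (‖z‖ + 1) * ‖g‖ := by
  let L₁ : (Fin n → ℝ) →L[ℝ] (Fin n → ℝ) := (resolventMatrix β P).mulVecLin.toContinuousLinearMap
  let L₂ : (Fin n → ℝ) →ₗ[ℝ] (Fin n → Fin m → ℝ) :=
    { toFun := fun g i => (P * Z * diagonal (resolventMatrix β P *ᵥ g) * Φ) i
      map_add' := fun g g' => by
        rw [mulVec_add, show diagonal (resolventMatrix β P *ᵥ g + resolventMatrix β P *ᵥ g') =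
          diagonal (resolventMatrix β P *ᵥ g) + diagonal (resolventMatrix β P *ᵥ g') from
          (diagonal_add _ _).symm, Matrix.mul_add, Matrix.add_mul]
        rfl
      map_smul' := fun a g => by
        rw [mulVec_smul, diagonal_smul, Matrix.mul_smul, Matrix.smul_mul]
        rfl }
  let L₃ := L₂.toContinuousLinearMap
  refine ⟨‖L₁‖ + ‖L₃‖, by positivity, fun z i g => ?_⟩
  have h1 : ‖(resolventMatrix β P *ᵥ g) i‖ ≤ ‖L₁‖ * ‖g‖ :=
    (norm_le_pi_norm (L₁ g) i).trans (L₁.le_opNorm g)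
  have h2 : ‖(P * Z * diagonal (resolventMatrix β P *ᵥ g) * Φ) i‖ ≤ ‖L₃‖ * ‖g‖ :=
    (norm_le_pi_norm (L₃ g) i).trans (L₃.le_opNorm g)
  refine (norm_add_le _ _).trans ?_
  rw [norm_smul]
  have h3 := mul_le_mul_of_nonneg_right h1 (norm_nonneg z)
  have h4 : 0 ≤ ‖L₁‖ * ‖g‖ := by positivity
  have h5 : 0 ≤ ‖L₃‖ * ‖g‖ * ‖z‖ := by positivity
  nlinarith

theorem continuous_tracePotential (P Z : Matrix (Fin n) (Fin n) ℝ)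
    (Φ : Matrix (Fin n) (Fin m) ℝ) (β : ℝ) (i : Fin n) :
    Continuous fun p : (Fin m → ℝ) × (Fin n → ℝ) => tracePotential P Z Φ β p.1 i p.2 := by
  have h1 : Continuous fun p : (Fin m → ℝ) × (Fin n → ℝ) => resolventMatrix β P *ᵥ p.2 :=
    continuous_const.matrix_mulVec continuous_snd
  have h2 : Continuous fun p : (Fin m → ℝ) × (Fin n → ℝ) =>
      P * Z * diagonal (resolventMatrix β P *ᵥ p.2) * Φ :=
    (continuous_const.matrix_mul h1.matrix_diagonal).matrix_mul continuous_const
  exact (((continuous_apply i).comp h1).smul continuous_fst).add ((continuous_apply i).comp h2)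

theorem exists_norm_eligibilityTrace_le (Φ : Matrix (Fin n) (Fin m) ℝ) {β : ℝ} (hβ0 : 0 ≤ β)
    (hβ1 : β < 1) : ∃ B ≥ 0, ∀ x t, ‖eligibilityTrace Φ β x t‖ ≤ B := by
  set C := ∑ i, ‖Φ i‖
  have hC : ∀ i, ‖Φ i‖ ≤ C := fun i =>
    Finset.single_le_sum (f := fun i => ‖Φ i‖) (fun i _ => norm_nonneg _) (Finset.mem_univ i)
  have hC0 : 0 ≤ C := Finset.sum_nonneg fun i _ => norm_nonneg _
  have hb : 0 < 1 - β := by linarith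
  have hCB : C ≤ C / (1 - β) := by
    rw [le_div_iff₀ hb]; nlinarith
  refine ⟨C / (1 - β), by positivity, fun x t => ?_⟩
  induction t with
  | zero =>
    simp only [eligibilityTrace, smul_zero, zero_add]
    exact (hC _).trans hCB
  | succ t ih =>
    rw [eligibilityTrace]
    refine (norm_add_le _ _).trans ?_
    rw [norm_smul, Real.norm_of_nonneg hβ0]
    have h1 := mul_le_mul_of_nonneg_left ih hβ0
    have h2 := hC (x (t + 1))
    have h3 : β * (C / (1 - β)) + C = C / (1 - β) := by field_simp; ring
    linarith

theorem exists_lipschitz_temporalDifference {σ : Fin n → (Fin n → ℝ) → (Fin n → ℝ) → ℝ}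
    {P : Matrix (Fin n) (Fin n) ℝ} (hP : P ∈ rowStochastic ℝ (Fin n))
    (hσ : IsTransitionRiskMapping σ) (c : Fin n → ℝ) (Φ : Matrix (Fin n) (Fin m) ℝ) (α : ℝ) :
    ∃ L ≥ 0, ∀ r s, ‖temporalDifference σ P c Φ α r - temporalDifference σ P c Φ α s‖ ≤
      L * ‖r - s‖ := by
  let T := Φ.mulVecLin.toContinuousLinearMap
  refine ⟨(1 + |α|) * ‖T‖, by positivity, fun r s => ?_⟩
  refine (norm_temporalDifference_sub_le hP hσ c Φ α r s).trans ?_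
  rw [mul_assoc]
  exact mul_le_mul_of_nonneg_left (T.le_opNorm (r - s)) (by positivity)

end TracePotential

/-! ### Weights modulo the kernel of the feature matrix. -/

section FeatureSpace
variable {n m : ℕ}

/-- The orthogonal complement of the kernel of `Φ` in Euclidean space. -/
noncomputable abbrev featureSpace (Φ : Matrix (Fin n) (Fin m) ℝ) : Submodule ℝ (EuclideanSpace ℝ (Fin m)) :=
  (LinearMap.ker (Φ.mulVecLin ∘ₗ (WithLp.linearEquiv 2 ℝ (Fin m → ℝ)).toLinearMap))ᗮ

/-- The projection of weights to the feature space. -/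
noncomputable def toFeatureSpace (Φ : Matrix (Fin n) (Fin m) ℝ) :
    (Fin m → ℝ) →L[ℝ] featureSpace Φ :=
  (featureSpace Φ).orthogonalProjectionOnto ∘L
    (EuclideanSpace.equiv (Fin m) ℝ).symm.toContinuousLinearMap

theorem mulVec_toFeatureSpace (Φ : Matrix (Fin n) (Fin m) ℝ) (r : Fin m → ℝ) :
    Φ *ᵥ (toFeatureSpace Φ r : EuclideanSpace ℝ (Fin m)).ofLp = Φ *ᵥ r := by
  have h := (featureSpace Φ).sub_starProjection_mem_orthogonal (WithLp.toLp 2 r)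
  rw [Submodule.orthogonal_orthogonal] at h
  have h1 : Φ *ᵥ (r - (toFeatureSpace Φ r : EuclideanSpace ℝ (Fin m)).ofLp) = 0 := h
  rw [mulVec_sub, sub_eq_zero] at h1
  exact h1.symm

theorem inner_toFeatureSpace (Φ : Matrix (Fin n) (Fin m) ℝ) (y : featureSpace Φ)
    (r : Fin m → ℝ) :
    inner ℝ y (toFeatureSpace Φ r) = (y : EuclideanSpace ℝ (Fin m)).ofLp ⬝ᵥ r := by
  have h := (featureSpace Φ).sub_starProjection_mem_orthogonal (WithLp.toLp 2 r)
  have h1 := h y y.2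
  rw [inner_sub_right, sub_eq_zero] at h1
  have h2 : inner ℝ y (toFeatureSpace Φ r) =
    inner ℝ (y : EuclideanSpace ℝ (Fin m)) ((featureSpace Φ).starProjection (WithLp.toLp 2 r)) := rfl
  rw [h2, ← h1, EuclideanSpace.inner_eq_star_dotProduct]
  simp [dotProduct_comm]

/-- The weighted map is injective off the kernel of Φ, and an injective linear map on a
finite-dimensional space is bounded below. -/
theorem exists_mul_norm_sq_le_featureSpace (Φ : Matrix (Fin n) (Fin m) ℝ) {q : Fin n → ℝ}
    (hq : ∀ i, 0 < q i) : ∃ c > 0, ∀ y : featureSpace Φ,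
      c * ‖y‖ ^ 2 ≤ ∑ i, q i * (Φ *ᵥ (y : EuclideanSpace ℝ (Fin m)).ofLp) i ^ 2 := by
  let D : featureSpace Φ →ₗ[ℝ] EuclideanSpace ℝ (Fin n) :=
    { toFun := fun y => WithLp.toLp 2 fun i =>
        Real.sqrt (q i) * (Φ *ᵥ (y : EuclideanSpace ℝ (Fin m)).ofLp) i
      map_add' := fun a b => by ext i; simp [mulVec_add, mul_add]
      map_smul' := fun a b => by ext i; simp [mulVec_smul]; ring }
  have hker : LinearMap.ker D = ⊥ := by
    rw [LinearMap.ker_eq_bot']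
    intro y hy
    have h1 : Φ *ᵥ (y : EuclideanSpace ℝ (Fin m)).ofLp = 0 := by
      ext i
      have := congrArg (fun v : EuclideanSpace ℝ (Fin n) => v i) hy
      simpa [D, (Real.sqrt_pos.2 (hq i)).ne'] using this
    have h2 : inner ℝ (y : EuclideanSpace ℝ (Fin m)) (y : EuclideanSpace ℝ (Fin m)) = 0 := y.2 _ h1
    exact Subtype.ext (inner_self_eq_zero.1 h2)
  obtain ⟨K, hK, hanti⟩ := D.exists_antilipschitzWith hker
  have hK' : (0 : ℝ) < K := hK
  refine ⟨1 / (K : ℝ) ^ 2, by positivity, fun y => ?_⟩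
  have h1 : ‖y‖ ≤ K * ‖D y‖ := by simpa using hanti.le_mul_dist y 0
  have h2 : ‖D y‖ ^ 2 = ∑ i, q i * (Φ *ᵥ (y : EuclideanSpace ℝ (Fin m)).ofLp) i ^ 2 := by
    rw [EuclideanSpace.norm_sq_eq]
    exact Finset.sum_congr rfl fun i _ => by simp [D, mul_pow, Real.sq_sqrt (hq i).le]
  rw [← h2, one_div_mul_eq_div, div_le_iff₀ (by positivity), mul_comm, ← mul_pow]
  exact pow_le_pow_left₀ (norm_nonneg _) h1 2

end FeatureSpace

/-! ### The deterministic argument along one path. -/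

section Pathwise
variable {n m : ℕ}

/-- A path of the stochastic approximation method, along which the martingale noises are summable
and the iterates are bounded, accumulates only at solutions. -/
theorem solves_of_path {P : Matrix (Fin n) (Fin n) ℝ} (hP : P ∈ rowStochastic ℝ (Fin n))
    {q : Fin n → ℝ} (hq : IsStationaryLaw P q) (hqpos : ∀ i, 0 < q i) (c : Fin n → ℝ)
    {σ : Fin n → (Fin n → ℝ) → (Fin n → ℝ) → ℝ} (hσ : IsTransitionRiskMapping σ)
    (hac : ∀ i, ∀ μ ∈ riskMultikernel σ i (P i), ∀ j, P i j = 0 → μ j = 0)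
    (Φ : Matrix (Fin n) (Fin m) ℝ) {α lam : ℝ} (hα0 : 0 < α) (hα1 : α < 1)
    (hlam0 : 0 ≤ lam) (hlam1 : lam ≤ 1) (hcontr : α * (1 + distortionCoeff σ P) < 1)
    {Z : Matrix (Fin n) (Fin n) ℝ} (hZ : (1 - P) * Z = 1 - Matrix.of fun _ j => q j)
    {x : ℕ → Fin n} {r : ℕ → Fin m → ℝ} {γ ξ : ℕ → ℝ}
    (hstep : ∀ t, r (t + 1) = r t - (γ t * (temporalDifference σ P c Φ α (r t) (x t) - α * ξ t)) •
        eligibilityTrace Φ (lam * α) x t)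
    {Br : ℝ} (hr : ∀ t, ‖r t‖ ≤ Br)
    (hpos : ∀ t, 0 < γ t) (h0 : Tendsto γ atTop (𝓝 0))
    (hsum : Tendsto (fun T => ∑ t ∈ Finset.range T, γ t) atTop atTop)
    (hwin : ∀ δ > (0 : ℝ), ∀ᶠ t₀ in atTop, ∀ T, ∑ t ∈ Finset.Icc t₀ T, γ t ≤ 2 →
      ∑ t ∈ Finset.Icc t₀ T, |γ t - γ (t + 1)| ≤ δ)
    (hsq : Summable fun t => γ t ^ 2) (hξsq : Summable fun t => (γ t * ξ t) ^ 2)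
    (hξ : ∃ l, Tendsto (fun T => ∑ t ∈ Finset.range T,
      (γ t * ξ t) • eligibilityTrace Φ (lam * α) x t) atTop (𝓝 l))
    (hD : ∃ l, Tendsto (fun T => ∑ t ∈ Finset.range T, γ t • ∑ j,
      ((if x (t + 1) = j then 1 else 0) - P (x t) j) •
        tracePotential P Z Φ (lam * α) ((lam * α) • eligibilityTrace Φ (lam * α) x t + Φ j) j
          (temporalDifference σ P c Φ α (r t))) atTop (𝓝 l))
    {r' : Fin m → ℝ} (hr' : MapClusterPt r' atTop r) :
    SolvesProjectedMultistepEquation σ P q c Φ α lam r' := by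
  set β := lam * α
  have hβ0 : 0 ≤ β := mul_nonneg hlam0 hα0.le
  have hβα : β ≤ α := mul_le_of_le_one_left hα0.le hlam1
  have hβ1 : β < 1 := hβα.trans_lt hα1
  set z := eligibilityTrace Φ β x
  have hzsucc : ∀ t, z (t + 1) = β • z t + Φ (x (t + 1)) := fun t => rfl
  set g := temporalDifference σ P c Φ α
  set S := tracePotential P Z Φ β
  set D : ℕ → Fin m → ℝ := fun t => ∑ j, ((if x (t + 1) = j then (1 : ℝ) else 0) - P (x t) j) •
    S (β • z t + Φ j) j (g (r t))
  -- The indicator selects the realized transition, for which β z_t + φ(x_{t+1}) = z_{t+1}. Hence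
  -- `D` is the new potential minus its conditional mean.
  have hDeq : ∀ t, D t = S (z (t + 1)) (x (t + 1)) (g (r t)) -
      ∑ j, P (x t) j • S (β • z t + Φ j) j (g (r t)) := by
    intro t
    simp only [D, sub_smul, Finset.sum_sub_distrib, ite_smul, one_smul, zero_smul,
      Finset.sum_ite_eq, Finset.mem_univ, if_true, hzsucc]
  have hpot : ∀ t, g (r t) (x t) • z t = meanField P q Φ β (g (r t)) + S (z t) (x t) (g (r t)) -
      S (z (t + 1)) (x (t + 1)) (g (r t)) + D t := by
    intro t
    have := tracePotential_sub_expected hP hZ Φ hβ0 hβ1 (z t) (x t) (g (r t))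
    rw [hDeq, ← sub_eq_iff_eq_add'.2 (sub_eq_iff_eq_add.1 this)]
    simp only [S]
    abel
  obtain ⟨Bz, hBz0, hBz⟩ := exists_norm_eligibilityTrace_le Φ hβ0 hβ1
  obtain ⟨C, hC0, hC⟩ := exists_norm_tracePotential_le P Z Φ β
  obtain ⟨L, hL0, hL⟩ := exists_lipschitz_temporalDifference hP hσ c Φ α
  have hz : ∀ t, ‖z t‖ ≤ Bz := fun t => hBz x t
  have hBr0 : 0 ≤ Br := (norm_nonneg _).trans (hr 0)
  set G := ‖g 0‖ + L * Br
  have hG0 : 0 ≤ G := by positivity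
  have hg : ∀ t, ‖g (r t)‖ ≤ G := by
    intro t
    have h1 := hL (r t) 0
    rw [sub_zero] at h1
    have h2 := norm_le_norm_add_norm_sub' (g (r t)) (g 0)
    have h3 := mul_le_mul_of_nonneg_left (hr t) hL0
    simp only [G]
    linarith
  have hS : ∀ t s v, ‖S (z t) s v‖ ≤ C * (Bz + 1) * ‖v‖ := fun t s v =>
    (hC _ _ _).trans (by have := hz t; gcongr)
  have hSB : ∀ t, ‖S (z t) (x t) (g (r t))‖ ≤ C * (Bz + 1) * G := fun t =>
    (hS _ _ _).trans (mul_le_mul_of_nonneg_left (hg t) (by positivity))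
  have hinc : ∀ t, ‖r (t + 1) - r t‖ ≤ γ t * ((G + α * |ξ t|) * Bz) := by
    intro t
    rw [hstep t, sub_sub_cancel_left, norm_neg, norm_smul, norm_mul, Real.norm_of_nonneg (hpos t).le,
      mul_assoc]
    refine mul_le_mul_of_nonneg_left ?_ (hpos t).le
    refine mul_le_mul ?_ (hz t) (norm_nonneg _) (by positivity)
    refine (norm_sub_le _ _).trans (add_le_add ((norm_le_pi_norm _ _).trans (hg t)) ?_)
    rw [norm_mul, Real.norm_of_nonneg hα0.le, Real.norm_eq_abs]
  -- Telescoping needs the potential at time t + 1 evaluated at r_{t+1}, not r_t. The exchange costs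
  -- γ_t times an increment of order γ_t (1 + |ξ_t|), which is summable.
  set W : ℕ → Fin m → ℝ := fun t => γ t • (S (z (t + 1)) (x (t + 1)) (g (r t)) -
    S (z (t + 1)) (x (t + 1)) (g (r (t + 1))))
  have hW : Summable W := by
    set A := C * (Bz + 1) * L * Bz
    have hA0 : 0 ≤ A := by positivity
    refine Summable.of_norm_bounded
      (g := fun t => A * G * γ t ^ 2 + A * α * (γ t ^ 2 + (γ t * ξ t) ^ 2)) ?_ fun t => ?_
    · exact (hsq.mul_left _).add ((hsq.add hξsq).mul_left _)
    · simp only [W, S]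
      rw [← tracePotential_sub, norm_smul, Real.norm_of_nonneg (hpos t).le]
      have h1 := hS (t + 1) (x (t + 1)) (g (r t) - g (r (t + 1)))
      have h2 : ‖g (r t) - g (r (t + 1))‖ ≤ L * (γ t * ((G + α * |ξ t|) * Bz)) := by
        refine (hL (r t) (r (t + 1))).trans (mul_le_mul_of_nonneg_left ?_ hL0)
        rw [norm_sub_rev]
        exact hinc t
      have h3 : γ t * ‖S (z (t + 1)) (x (t + 1)) (g (r t) - g (r (t + 1)))‖ ≤
          γ t * (C * (Bz + 1) * (L * (γ t * ((G + α * |ξ t|) * Bz)))) := by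
        refine mul_le_mul_of_nonneg_left (h1.trans ?_) (hpos t).le
        exact mul_le_mul_of_nonneg_left h2 (by positivity)
      refine h3.trans ?_
      have h4 : γ t * (γ t * |ξ t|) ≤ γ t ^ 2 + (γ t * ξ t) ^ 2 := by
        have h5 : (γ t * ξ t) ^ 2 = (γ t * |ξ t|) ^ 2 := by rw [mul_pow, mul_pow, sq_abs]
        rw [h5]
        nlinarith [sq_nonneg (γ t - γ t * |ξ t|), sq_nonneg (γ t), sq_nonneg (γ t * |ξ t|)]
      have h6 := mul_le_mul_of_nonneg_left h4 (mul_nonneg hA0 hα0.le)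
      have h7 : γ t * (C * (Bz + 1) * (L * (γ t * ((G + α * |ξ t|) * Bz)))) =
          A * G * γ t ^ 2 + A * α * (γ t * (γ t * |ξ t|)) := by simp only [A]; ring
      rw [h7]
      linarith
  obtain ⟨lξ, hlξ⟩ := hξ
  obtain ⟨lD, hlD⟩ := hD
  set N : ℕ → Fin m → ℝ := fun T => -∑ t ∈ Finset.range T, γ t • D t +
    α • ∑ t ∈ Finset.range T, (γ t * ξ t) • z t + ∑ t ∈ Finset.range T, W t
  set N' := -lD + α • lξ + ∑' t, W t
  have hN : Tendsto N atTop (𝓝 N') :=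
    (hlD.neg.add (hlξ.const_smul α)).add hW.hasSum.tendsto_sum_nat
  have hNsucc : ∀ t, N (t + 1) = N t - γ t • D t + (α * (γ t * ξ t)) • z t + W t := by
    intro t
    simp only [N, Finset.sum_range_succ, smul_add, smul_smul]
    abel
  -- This shift absorbs the tails of the convergent series and the boundary term of the summation by
  -- parts; only (γ_t - γ_{t+1}) S_{t+1} stays in the recursion.
  set e : ℕ → Fin m → ℝ := fun t => -(γ t • S (z t) (x t) (g (r t))) - (N t - N')
  have he : Tendsto e atTop (𝓝 0) := by
    have h1 : Tendsto (fun t => γ t • S (z t) (x t) (g (r t))) atTop (𝓝 0) := by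
      refine squeeze_zero_norm (a := fun t => γ t * (C * (Bz + 1) * G)) (fun t => ?_) ?_
      · rw [norm_smul, Real.norm_of_nonneg (hpos t).le]
        exact mul_le_mul_of_nonneg_left (hSB t) (hpos t).le
      · simpa using h0.mul_const (C * (Bz + 1) * G)
    simpa using h1.neg.sub (hN.sub_const N')
  have hrec : ∀ t, r (t + 1) + e (t + 1) = r t + e t - γ t • meanField P q Φ β (g (r t)) +
      (γ t - γ (t + 1)) • S (z (t + 1)) (x (t + 1)) (g (r (t + 1))) := by
    intro t
    have h1 : (γ t * (g (r t) (x t) - α * ξ t)) • z t =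
        γ t • (g (r t) (x t) • z t) - (α * (γ t * ξ t)) • z t := by
      rw [smul_smul, ← sub_smul]; congr 1; ring
    simp only [e]
    have h2 : r (t + 1) = r t - γ t • (meanField P q Φ β (g (r t)) + S (z t) (x t) (g (r t)) -
        S (z (t + 1)) (x (t + 1)) (g (r t)) + D t) + (α * (γ t * ξ t)) • z t := by
      rw [← hpot t, hstep t, h1]; abel
    rw [hNsucc]
    simp only [W]
    generalize S (z (t + 1)) (x (t + 1)) (g (r (t + 1))) = S'
    rw [h2]
    simp only [smul_sub, smul_add, sub_smul]
    abel
  set T := toFeatureSpace Φ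
  obtain ⟨κ₁, hκ₁, hmono⟩ := exists_strongMonotone_meanField hP hq hσ hac c Φ hβ0 hβα hcontr
  obtain ⟨κ₂, hκ₂, hcoer⟩ := exists_mul_norm_sq_le_featureSpace Φ hqpos
  let lift : featureSpace Φ → Fin m → ℝ := fun y => (y : EuclideanSpace ℝ (Fin m)).ofLp
  have hgT : ∀ s, g (lift (T s)) = g s := by
    intro s
    have : Φ *ᵥ lift (T s) = Φ *ᵥ s := mulVec_toFeatureSpace Φ s
    simp only [g, temporalDifference, this]
  let h : featureSpace Φ → featureSpace Φ := fun y => T (meanField P q Φ β (g (lift y)))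
  let H : (Fin n → ℝ) →ₗ[ℝ] featureSpace Φ :=
    { toFun := fun v => T (meanField P q Φ β v)
      map_add' := fun v w => by simp only [meanField, mulVec_add, mul_add, map_add]
      map_smul' := fun a v => by
        simp only [meanField, mulVec_smul, mul_smul_comm, map_smul, RingHom.id_apply] }
  let Hc := H.toContinuousLinearMap
  let Ψ : featureSpace Φ →ₗ[ℝ] (Fin n → ℝ) :=
    Φ.mulVecLin ∘ₗ (WithLp.linearEquiv 2 ℝ (Fin m → ℝ)).toLinearMap ∘ₗ (featureSpace Φ).subtype
  let Ψc := Ψ.toContinuousLinearMap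
  have hmono' : ∀ y w, κ₁ * κ₂ * ‖y - w‖ ^ 2 ≤ inner ℝ (y - w) (h y - h w) := by
    intro y w
    have h1 : h y - h w = T (meanField P q Φ β (g (lift y)) - meanField P q Φ β (g (lift w))) :=
      (map_sub T _ _).symm
    rw [h1, inner_toFeatureSpace]
    refine le_trans ?_ (hmono (lift y) (lift w))
    rw [mul_assoc]
    exact mul_le_mul_of_nonneg_left (hcoer (y - w)) hκ₁.le
  have hlip' : ∀ y w, ‖h y - h w‖ ≤ ‖Hc‖ * ((1 + |α|) * ‖Ψc‖) * ‖y - w‖ := by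
    intro y w
    have h1 : h y - h w = Hc (g (lift y) - g (lift w)) := (map_sub Hc _ _).symm
    rw [h1, mul_assoc, mul_assoc]
    refine (Hc.le_opNorm _).trans (mul_le_mul_of_nonneg_left ?_ (norm_nonneg _))
    refine (norm_temporalDifference_sub_le hP hσ c Φ α _ _).trans ?_
    exact mul_le_mul_of_nonneg_left (Ψc.le_opNorm (y - w)) (by positivity)
  have hwin' : ∀ δ > 0, ∀ᶠ s in atTop, ∀ t, ∑ k ∈ Finset.Ico s t, γ k ≤ 2 → ∑ k ∈ Finset.Ico s t,
      ‖T ((γ k - γ (k + 1)) • S (z (k + 1)) (x (k + 1)) (g (r (k + 1))))‖ ≤ δ := by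
    intro δ hδ
    -- The summand 1 only makes the divisor positive.
    set A := ‖T‖ * (C * (Bz + 1) * G) + 1
    have hA : 0 < A := by positivity
    filter_upwards [hwin (δ / A) (by positivity)] with s hs t ht
    rcases t with _ | t
    · simpa using hδ.le
    · have hI : Finset.Ico s (t + 1) = Finset.Icc s t := by ext; simp
      rw [hI] at ht ⊢
      have h1 := hs t ht
      rw [le_div_iff₀ hA, Finset.sum_mul] at h1
      refine le_trans (Finset.sum_le_sum fun k _ => ?_) h1
      refine (T.le_opNorm _).trans ?_
      rw [norm_smul, Real.norm_eq_abs]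
      have h2 := mul_le_mul_of_nonneg_left (hSB (k + 1)) (norm_nonneg T)
      have h3 := mul_le_mul_of_nonneg_left (h2.trans (le_add_of_nonneg_right zero_le_one))
        (abs_nonneg (γ k - γ (k + 1)))
      calc _ = |γ k - γ (k + 1)| * (‖T‖ * ‖S (z (k + 1)) (x (k + 1)) (g (r (k + 1)))‖) := by ring
        _ ≤ _ := h3
  have hrec' : ∀ t, T (r (t + 1)) + T (e (t + 1)) = T (r t) + T (e t) - γ t • h (T (r t)) +
      T ((γ t - γ (t + 1)) • S (z (t + 1)) (x (t + 1)) (g (r (t + 1)))) := by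
    intro t
    have h1 : h (T (r t)) = T (meanField P q Φ β (g (r t))) := by simp only [h, hgT]
    rw [h1, ← map_smul, ← map_add, ← map_add, ← map_sub, ← map_add, hrec t]
  obtain ⟨y₀, hy₀, hlim⟩ := exists_tendsto_zero_of_strongMonotone (mul_pos hκ₁ hκ₂) (by positivity)
    hmono' hlip' hpos h0 hsum (y := fun t => T (r t)) (e := fun t => T (e t))
    (b := fun t => T ((γ t - γ (t + 1)) • S (z (t + 1)) (x (t + 1)) (g (r (t + 1)))))
    (B := ‖T‖ * Br) (fun t => (T.le_opNorm _).trans (mul_le_mul_of_nonneg_left (hr t) (norm_nonneg _)))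
    (by simpa [Function.comp_def] using (T.continuous.tendsto 0).comp he) hwin' hrec'
  have h1 : MapClusterPt (T r') atTop (fun t => T (r t)) :=
    hr'.continuousAt_comp T.continuous.continuousAt
  have h2 : T r' = y₀ := by
    have h3 : ClusterPt (T r') (𝓝 y₀) := ClusterPt.mono h1 hlim
    exact eq_of_nhds_neBot h3
  have h3 : T (meanField P q Φ β (g r')) = 0 := by
    rw [← hy₀, ← h2, ← hgT r']
  refine solves_of_meanField_eq_zero hq.1.1 ?_
  -- The projection of the mean field vanishes, so the mean field lies in ker Φ. It also lies in the
  -- range of Φᵀ, hence it is orthogonal to itself.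
  have h4 : meanField P q Φ β (g r') ⬝ᵥ meanField P q Φ β (g r') = 0 := by
    have h5 := dotProduct_meanField P q Φ β (g r')
    rw [h5, ← mulVec_toFeatureSpace Φ (meanField P q Φ β (g r'))]
    rw [show toFeatureSpace Φ (meanField P q Φ β (g r')) = 0 from h3]
    simp
  exact dotProduct_self_eq_zero.1 h4

end Pathwise

/-! ### Adaptedness to the history. -/

section Measurability
variable {Ω : Type*} {n m : ℕ} {x : ℕ → Ω → Fin n} {r : ℕ → Ω → Fin m → ℝ}

theorem measurable_state_historySigma {s t : ℕ} (h : s ≤ t) :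
    Measurable[historySigma x r t] (x s) := by
  have h1 : MeasurableSpace.comap (x s) ⊤ ≤ historySigma x r t :=
    le_sup_left.trans (le_iSup₂_of_le (f := fun s (_ : s ∈ Set.Iic t) =>
      MeasurableSpace.comap (x s) ⊤ ⊔ MeasurableSpace.comap (r s) inferInstance) s h le_rfl)
  exact measurable_iff_comap_le.2 h1

theorem measurable_iterate_historySigma {s t : ℕ} (h : s ≤ t) :
    Measurable[historySigma x r t] (r s) := by
  have h1 : MeasurableSpace.comap (r s) inferInstance ≤ historySigma x r t :=
    le_sup_right.trans (le_iSup₂_of_le (f := fun s (_ : s ∈ Set.Iic t) =>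
      MeasurableSpace.comap (x s) ⊤ ⊔ MeasurableSpace.comap (r s) inferInstance) s h le_rfl)
  exact measurable_iff_comap_le.2 h1

/-- The filtration of the histories. -/
def historyFiltration {m0 : MeasurableSpace Ω} (hx : ∀ t, Measurable (x t))
    (hr : ∀ t, Measurable (r t)) : Filtration ℕ m0 where
  seq := historySigma x r
  mono' _ _ hst := iSup₂_le fun _ hu => sup_le
    (measurable_iff_comap_le.1 (measurable_state_historySigma (r := r) (le_trans hu hst)))
    (measurable_iff_comap_le.1 (measurable_iterate_historySigma (x := x) (le_trans hu hst)))
  le' _ := iSup₂_le fun u _ => sup_le (hx u).comap_le (hr u).comap_le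

theorem measurable_eligibilityTrace (Φ : Matrix (Fin n) (Fin m) ℝ) (β : ℝ) {s t : ℕ} (h : s ≤ t) :
    Measurable[historySigma x r t] fun ω => eligibilityTrace Φ β (fun u => x u ω) s := by
  have hΦ : ∀ u ≤ t, Measurable[historySigma x r t] fun ω => Φ (x u ω) := fun u hu =>
    (measurable_of_finite Φ).comp (measurable_state_historySigma hu)
  induction s with
  | zero =>
    simp only [eligibilityTrace, smul_zero, zero_add]
    exact hΦ 0 h
  | succ s ih =>
    simp only [eligibilityTrace]
    exact ((ih (Nat.le_of_succ_le h)).const_smul β).add (hΦ _ h)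

end Measurability

/-! ### Truncated stepsizes and almost sure convergence of weighted noises. -/

/-- Convergence of a series does not depend on finitely many terms. -/
theorem exists_tendsto_sum_range_of_eventually_eq {E : Type*} [AddCommGroup E] [TopologicalSpace E]
    [ContinuousAdd E] {f g : ℕ → E} (hfg : ∀ᶠ t in atTop, f t = g t)
    (hf : ∃ l, Tendsto (fun T => ∑ t ∈ Finset.range T, f t) atTop (𝓝 l)) :
    ∃ l, Tendsto (fun T => ∑ t ∈ Finset.range T, g t) atTop (𝓝 l) := by
  obtain ⟨l, hl⟩ := hf
  obtain ⟨N, hN⟩ := eventually_atTop.1 hfg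
  refine ⟨l + (∑ t ∈ Finset.range N, g t + -∑ t ∈ Finset.range N, f t),
    (hl.add_const _).congr' ?_⟩
  filter_upwards [eventually_ge_atTop N] with T hT
  rw [← Finset.sum_range_add_sum_Ico f hT, ← Finset.sum_range_add_sum_Ico g hT,
    Finset.sum_congr rfl fun t ht => hN t (Finset.mem_Ico.1 ht).1]
  abel

/-- The stepsize, set to zero when it exceeds one. -/
noncomputable def cappedStep {Ω : Type*} (γ : ℕ → Ω → ℝ) (t : ℕ) (ω : Ω) : ℝ :=
  if |γ t ω| ≤ 1 then γ t ω else 0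

section Capped
variable {Ω : Type*} {γ : ℕ → Ω → ℝ}

theorem abs_cappedStep_le_one (t : ℕ) (ω : Ω) : |cappedStep γ t ω| ≤ 1 := by
  unfold cappedStep
  split_ifs with h
  · exact h
  · simp

theorem cappedStep_sq_le (t : ℕ) (ω : Ω) : cappedStep γ t ω ^ 2 ≤ γ t ω ^ 2 := by
  unfold cappedStep
  split_ifs
  · exact le_rfl
  · simpa using sq_nonneg (γ t ω)

/-- Capping supplies the bounded weights needed for square integrability, and it alters only
finitely many terms of almost every path. -/
theorem eventually_cappedStep_eq {ω : Ω} (h : Tendsto (fun t => γ t ω) atTop (𝓝 0)) :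
    ∀ᶠ t in atTop, cappedStep γ t ω = γ t ω := by
  have h1 : Tendsto (fun t => |γ t ω|) atTop (𝓝 0) := by simpa using h.abs
  filter_upwards [h1.eventually_le_const (show (0 : ℝ) < 1 by norm_num)] with t ht
  exact if_pos ht

theorem measurable_cappedStep {G : MeasurableSpace Ω} {t : ℕ} (h : Measurable[G] (γ t)) :
    Measurable[G] (cappedStep γ t) := by
  have hs : MeasurableSet[G] {ω | |γ t ω| ≤ 1} :=
    (measurable_norm.comp h) measurableSet_Iic
  exact Measurable.ite hs h measurable_const

variable {m0 : MeasurableSpace Ω} {μ : Measure Ω} [IsProbabilityMeasure μ]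

theorem summable_integral_cappedStep_sq (hγ : ∀ t, Measurable (γ t))
    (h : ∫⁻ ω, ∑' t, ENNReal.ofReal (γ t ω ^ 2) ∂μ < ⊤) :
    Summable fun t => ∫ ω, cappedStep γ t ω ^ 2 ∂μ := by
  rw [lintegral_tsum fun t => ((hγ t).pow_const 2).ennreal_ofReal.aemeasurable] at h
  refine Summable.of_nonneg_of_le (fun t => integral_nonneg fun ω => sq_nonneg _) (fun t => ?_)
    (ENNReal.summable_toReal h.ne)
  have hi : Integrable (fun ω => cappedStep γ t ω ^ 2) μ :=
    (MemLp.of_bound (p := 2) (measurable_cappedStep (hγ t)).aestronglyMeasurable 1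
      (Eventually.of_forall (abs_cappedStep_le_one t))).integrable_sq
  rw [integral_eq_lintegral_of_nonneg_ae (Eventually.of_forall fun ω => sq_nonneg _) hi.1]
  exact ENNReal.toReal_mono (ENNReal.ne_top_of_tsum_ne_top h.ne t)
    (lintegral_mono fun ω => ENNReal.ofReal_le_ofReal (cappedStep_sq_le t ω))

/-- A series of noises with bounded conditional variance, with the stepsizes times bounded
predictable factors as weights, converges. -/
theorem ae_exists_tendsto_sum_step_mul {F : Filtration ℕ m0}
    (hγ : StepsizeConditions μ F γ) {w D : ℕ → Ω → ℝ} {A K : ℝ}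
    (hw : ∀ t, Measurable[F t] (w t)) (hwA : ∀ t ω, |w t ω| ≤ A)
    (hD : ∀ t, MemLp (D t) 2 μ) (hmean : ∀ t, μ[D t | F t] =ᵐ[μ] 0)
    (hvar : ∀ t, ∀ᵐ ω ∂μ, (μ[fun ω' => D t ω' ^ 2 | F t]) ω ≤ K)
    (hadp : ∀ t, Measurable[F (t + 1)] fun ω => γ t ω * w t ω * D t ω) :
    ∀ᵐ ω ∂μ, ∃ l, Tendsto (fun T => ∑ t ∈ Finset.range T, γ t ω * w t ω * D t ω) atTop (𝓝 l) := by
  have hsum := summable_integral_cappedStep_sq (fun t => (hγ.adapted t).mono (F.le t) le_rfl)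
    hγ.sum_sq
  have hm : ∀ t, Measurable[F t] fun ω => cappedStep γ t ω * w t ω := fun t =>
    (measurable_cappedStep (hγ.adapted t)).mul (hw t)
  have hb : ∀ t ω, |cappedStep γ t ω * w t ω| ≤ |cappedStep γ t ω| * A := fun t ω => by
    rw [abs_mul]; exact mul_le_mul_of_nonneg_left (hwA t ω) (abs_nonneg _)
  have hb1 : ∀ t ω, |cappedStep γ t ω * w t ω| ≤ A := fun t ω => (hb t ω).trans
    (mul_le_of_le_one_left ((abs_nonneg _).trans (hwA t ω)) (abs_cappedStep_le_one t ω))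
  have hconv := ae_exists_tendsto_sum_mul_of_condVar_le (F := F)
    (a := fun t ω => cappedStep γ t ω * w t ω) (D := D) (A := A) (K := K)
    (fun t => (hm t).stronglyMeasurable) hb1 ?_ hD hmean hvar fun t => ?_
  · filter_upwards [hconv, hγ.tendsto_zero] with ω h h0
    refine exists_tendsto_sum_range_of_eventually_eq ?_ h
    filter_upwards [eventually_cappedStep_eq h0] with t ht
    rw [ht]
  · refine Summable.of_nonneg_of_le (fun t => integral_nonneg fun ω => sq_nonneg _) (fun t => ?_)
      (hsum.mul_left (A ^ 2))
    have hi : Integrable (fun ω => cappedStep γ t ω ^ 2) μ :=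
      (MemLp.of_bound (p := 2) ((measurable_cappedStep (hγ.adapted t)).mono (F.le t)
        le_rfl).aestronglyMeasurable 1
        (Eventually.of_forall (abs_cappedStep_le_one t))).integrable_sq
    rw [← integral_const_mul]
    refine integral_mono_of_nonneg (Eventually.of_forall fun ω => sq_nonneg _)
      (hi.const_mul _) (Eventually.of_forall fun ω => ?_)
    have h1 := pow_le_pow_left₀ (abs_nonneg _) (hb t ω) 2
    rw [sq_abs, mul_pow |cappedStep γ t ω|, sq_abs] at h1
    simp only
    linarith
  · have hs : MeasurableSet[F (t + 1)] {ω | |γ t ω| ≤ 1} :=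
      (measurable_norm.comp ((hγ.adapted t).mono (F.mono (Nat.le_succ t)) le_rfl)) measurableSet_Iic
    -- Only the full product with `D` is known to be measurable at time t + 1, so the capped product
    -- is written as that product or zero.
    have h1 : (fun ω => cappedStep γ t ω * w t ω * D t ω) = fun ω =>
        if |γ t ω| ≤ 1 then γ t ω * w t ω * D t ω else 0 := by
      ext ω
      unfold cappedStep
      split_ifs <;> simp
    rw [h1]
    exact (Measurable.ite hs (hadp t) measurable_const).stronglyMeasurable

theorem ae_summable_sq_step_mul {F : Filtration ℕ m0}
    (hγ : StepsizeConditions μ F γ) {D : ℕ → Ω → ℝ} {K : ℝ}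
    (hD : ∀ t, MemLp (D t) 2 μ)
    (hvar : ∀ t, ∀ᵐ ω ∂μ, (μ[fun ω' => D t ω' ^ 2 | F t]) ω ≤ K) :
    ∀ᵐ ω ∂μ, Summable fun t => (γ t ω * D t ω) ^ 2 := by
  have hsum := summable_integral_cappedStep_sq (fun t => (hγ.adapted t).mono (F.le t) le_rfl)
    hγ.sum_sq
  have h := ae_summable_sq_mul_of_condVar_le (F := F) (a := cappedStep γ) (A := 1)
    (fun t => (measurable_cappedStep (hγ.adapted t)).stronglyMeasurable) abs_cappedStep_le_one hsum
    hD hvar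
  filter_upwards [h, hγ.tendsto_zero] with ω h h0
  refine (summable_congr_atTop ?_).1 h
  filter_upwards [eventually_cappedStep_eq h0] with t ht
  rw [ht]

end Capped

theorem ae_summable_step_sq {Ω : Type*} {m0 : MeasurableSpace Ω} {μ : Measure Ω}
    {F : Filtration ℕ m0} {γ : ℕ → Ω → ℝ} (hγ : StepsizeConditions μ F γ) :
    ∀ᵐ ω ∂μ, Summable fun t => γ t ω ^ 2 := by
  have hm : ∀ t, Measurable fun ω => ENNReal.ofReal (γ t ω ^ 2) := fun t =>
    (((hγ.adapted t).mono (F.le t) le_rfl).pow_const 2).ennreal_ofReal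
  have := ae_lt_top (Measurable.tsum hm) hγ.sum_sq.ne
  filter_upwards [this] with ω hω
  exact (ENNReal.summable_toReal hω.ne).congr fun t => ENNReal.toReal_ofReal (sq_nonneg _)

/-! ### Martingale differences of the transitions. -/

section Transition
variable {Ω : Type*} {m0 : MeasurableSpace Ω} {μ : Measure Ω} [IsProbabilityMeasure μ]
  {F : Filtration ℕ m0} {n : ℕ} {P : Matrix (Fin n) (Fin n) ℝ} {x : ℕ → Ω → Fin n}

/-- The deviation of the indicator of a transition to `j` from the transition probability. -/
def transitionNoise (P : Matrix (Fin n) (Fin n) ℝ) (x : ℕ → Ω → Fin n) (j : Fin n) (t : ℕ)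
    (ω : Ω) : ℝ :=
  (if x (t + 1) ω = j then 1 else 0) - P (x t ω) j

theorem measurable_transitionNoise {G : MeasurableSpace Ω} {j : Fin n} {t : ℕ}
    (h0 : Measurable[G] (x t)) (h1 : Measurable[G] (x (t + 1))) :
    Measurable[G] (transitionNoise P x j t) :=
  (((measurable_of_finite fun i : Fin n => if i = j then (1 : ℝ) else 0).comp h1)).sub
    ((measurable_of_finite fun i => P i j).comp h0)

theorem abs_transitionNoise_le (hP : P ∈ rowStochastic ℝ (Fin n)) (j : Fin n) (t : ℕ) (ω : Ω) :
    |transitionNoise P x j t ω| ≤ 1 := by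
  have h1 := nonneg_of_mem_rowStochastic hP (i := x t ω) (j := j)
  have h2 := le_one_of_mem_rowStochastic hP (i := x t ω) (j := j)
  unfold transitionNoise
  rw [abs_le]
  split_ifs <;> constructor <;> linarith

theorem condExp_transitionNoise (hP : P ∈ rowStochastic ℝ (Fin n))
    (hx : ∀ t, Measurable[F t] (x t)) (hM : IsMarkovTrajectory μ F P x) (j : Fin n) (t : ℕ) :
    μ[transitionNoise P x j t | F t] =ᵐ[μ] 0 := by
  have hx0 : ∀ t, Measurable (x t) := fun t => (hx t).mono (F.le t) le_rfl
  have h1 : transitionNoise P x j t =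
      (x (t + 1) ⁻¹' {j}).indicator (fun _ => (1 : ℝ)) - fun ω => P (x t ω) j := by
    ext ω
    by_cases h : x (t + 1) ω = j <;> simp [transitionNoise, h]
  have hPm : Measurable[F t] fun ω => P (x t ω) j :=
    (measurable_of_finite fun i => P i j).comp (hx t)
  have hPi : Integrable (fun ω => P (x t ω) j) μ :=
    Integrable.of_bound (hPm.mono (F.le t) le_rfl).aestronglyMeasurable 1
      (Eventually.of_forall fun ω => by
        rw [Real.norm_of_nonneg (nonneg_of_mem_rowStochastic hP)]
        exact le_one_of_mem_rowStochastic hP)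
  have hI : Integrable ((x (t + 1) ⁻¹' {j}).indicator (fun _ => (1 : ℝ))) μ :=
    (integrable_const 1).indicator (hx0 (t + 1) (measurableSet_singleton j))
  rw [h1]
  filter_upwards [condExp_sub hI hPi (F t), hM t j] with ω h2 h3
  rw [h2, Pi.sub_apply, h3, condExp_of_stronglyMeasurable (F.le t) hPm.stronglyMeasurable hPi]
  simp

theorem condExp_sq_transitionNoise_le (hP : P ∈ rowStochastic ℝ (Fin n))
    (hx : ∀ t, Measurable (x t)) (j : Fin n) (t : ℕ) :
    ∀ᵐ ω ∂μ, (μ[fun ω' => transitionNoise P x j t ω' ^ 2 | F t]) ω ≤ 1 := by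
  have hb : ∀ ω, transitionNoise P x j t ω ^ 2 ≤ 1 := fun ω => by
    rw [← sq_abs]
    exact pow_le_one₀ (abs_nonneg _) (abs_transitionNoise_le hP j t ω)
  have hi : Integrable (fun ω => transitionNoise P x j t ω ^ 2) μ :=
    Integrable.of_bound ((measurable_transitionNoise (hx t) (hx (t + 1))).pow_const
      2).aestronglyMeasurable 1 (Eventually.of_forall fun ω => by
        rw [Real.norm_of_nonneg (sq_nonneg _)]; exact hb ω)
  have h := condExp_mono (m := F t) hi (integrable_const (1 : ℝ)) (Eventually.of_forall hb)
  rw [condExp_const (F.le t)] at h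
  exact h

end Transition

theorem continuous_temporalDifference {n m : ℕ} {σ : Fin n → (Fin n → ℝ) → (Fin n → ℝ) → ℝ}
    {P : Matrix (Fin n) (Fin n) ℝ} (hP : P ∈ rowStochastic ℝ (Fin n))
    (hσ : IsTransitionRiskMapping σ) (c : Fin n → ℝ) (Φ : Matrix (Fin n) (Fin m) ℝ) (α : ℝ) :
    Continuous (temporalDifference σ P c Φ α) := by
  obtain ⟨L, hL0, hL⟩ := exists_lipschitz_temporalDifference hP hσ c Φ α
  refine (LipschitzWith.of_dist_le_mul (K := ⟨L, hL0⟩) fun r s => ?_).continuous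
  rw [dist_eq_norm, dist_eq_norm]
  exact hL r s

theorem exists_tendsto_pi {m : ℕ} {f : ℕ → Fin m → ℝ}
    (h : ∀ k, ∃ l, Tendsto (fun T => ∑ t ∈ Finset.range T, f t k) atTop (𝓝 l)) :
    ∃ l, Tendsto (fun T => ∑ t ∈ Finset.range T, f t) atTop (𝓝 l) := by
  choose l hl using h
  refine ⟨l, tendsto_pi_nhds.2 fun k => ?_⟩
  simpa only [Finset.sum_apply] using hl k

/-! ### The two noise series of the method. -/

section Noise
variable {Ω : Type*} {m0 : MeasurableSpace Ω} {μ : Measure Ω} [IsProbabilityMeasure μ]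
  {F : Filtration ℕ m0} {n m : ℕ} {x : ℕ → Ω → Fin n} {r z : ℕ → Ω → Fin m → ℝ} {γ ξ : ℕ → Ω → ℝ}

/-- The errors of the risk estimates contribute a convergent series. -/
theorem ae_exists_tendsto_sum_error (hγ : StepsizeConditions μ F γ) (hξ : ErrorConditions μ F ξ)
    (hx : ∀ t, Measurable[F t] (x t)) (hr : ∀ t, Measurable[F t] (r t))
    (hz : ∀ t, Measurable[F t] (z t)) {B : ℝ} (hzB : ∀ t ω, ‖z t ω‖ ≤ B)
    {g : (Fin m → ℝ) → Fin n → ℝ} (hg : Continuous g) {α : ℝ} (hα : α ≠ 0)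
    (hrec : ∀ t ω, r (t + 1) ω =
      r t ω - (γ t ω * (g (r t ω) (x t ω) - α * ξ t ω)) • z t ω) :
    ∀ᵐ ω ∂μ, ∃ l, Tendsto (fun T => ∑ t ∈ Finset.range T, (γ t ω * ξ t ω) • z t ω)
      atTop (𝓝 l) := by
  obtain ⟨K, hK⟩ := hξ.variance_bound
  have hF : ∀ t, F t ≤ F (t + 1) := fun t => F.mono (Nat.le_succ t)
  have hk : ∀ k, ∀ᵐ ω ∂μ, ∃ l, Tendsto (fun T => ∑ t ∈ Finset.range T,
      γ t ω * z t ω k * ξ t ω) atTop (𝓝 l) := by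
    intro k
    refine ae_exists_tendsto_sum_step_mul hγ (A := B) (K := K)
      (fun t => (measurable_pi_apply k).comp (hz t))
      (fun t ω => (norm_le_pi_norm (z t ω) k).trans (hzB t ω)) hξ.memLp hξ.mean_zero hK fun t => ?_
    -- The error ξ_t is not assumed adapted, but the recursion recovers γ_t z_t ξ_t from r_t,
    -- r_{t+1} and quantities known at time t, as α ≠ 0.
    have h1 : (fun ω => γ t ω * z t ω k * ξ t ω) = fun ω =>
        α⁻¹ * (r (t + 1) ω k - r t ω k + γ t ω * g (r t ω) (x t ω) * z t ω k) := by
      ext ω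
      rw [hrec t ω]
      simp only [Pi.sub_apply, Pi.smul_apply, smul_eq_mul]
      field_simp
      ring
    rw [h1]
    have hg1 : Measurable[F t] fun ω => g (r t ω) (x t ω) :=
      (measurable_from_prod_countable_left (f := fun p : (Fin m → ℝ) × Fin n => g p.1 p.2)
        fun i => ((continuous_apply i).comp hg).measurable).comp ((hr t).prodMk (hx t))
    have hr1 : Measurable[F (t + 1)] fun ω => r (t + 1) ω k :=
      (measurable_pi_apply k).comp (hr (t + 1))
    have h2 : Measurable[F t] fun ω => r t ω k := (measurable_pi_apply k).comp (hr t)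
    have h3 : Measurable[F t] fun ω => γ t ω * g (r t ω) (x t ω) * z t ω k :=
      ((hγ.adapted t).mul hg1).mul ((measurable_pi_apply k).comp (hz t))
    exact ((hr1.sub (h2.mono (hF t) le_rfl)).add (h3.mono (hF t) le_rfl)).const_mul _
  filter_upwards [ae_all_iff.2 hk] with ω h
  refine exists_tendsto_pi fun k => ?_
  obtain ⟨l, hl⟩ := h k
  refine ⟨l, hl.congr fun T => Finset.sum_congr rfl fun t _ => ?_⟩
  simp only [Pi.smul_apply, smul_eq_mul]
  ring

/-- The deviations of the transitions from their conditional means, with predictable coefficients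
`v j t` which are bounded as long as the iterates are, contribute a convergent series. -/
theorem ae_exists_tendsto_sum_transitionNoise {P : Matrix (Fin n) (Fin n) ℝ}
    (hP : P ∈ rowStochastic ℝ (Fin n)) (hM : IsMarkovTrajectory μ F P x)
    (hγ : StepsizeConditions μ F γ)
    (hx : ∀ t, Measurable[F t] (x t)) (hr : ∀ t, Measurable[F t] (r t))
    {v : Fin n → ℕ → Ω → Fin m → ℝ} (hv : ∀ j t, Measurable[F t] (v j t)) {A : ℝ → ℝ}
    (hA : ∀ R j t ω, ‖r t ω‖ ≤ R → ‖v j t ω‖ ≤ A R) :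
    ∀ᵐ ω ∂μ, Bornology.IsBounded (Set.range fun t => r t ω) →
      ∃ l, Tendsto (fun T => ∑ t ∈ Finset.range T, γ t ω • ∑ j,
        transitionNoise P x j t ω • v j t ω) atTop (𝓝 l) := by
  have hF : ∀ t, F t ≤ F (t + 1) := fun t => F.mono (Nat.le_succ t)
  have hx0 : ∀ t, Measurable (x t) := fun t => (hx t).mono (F.le t) le_rfl
  -- The iterates are bounded only path by path. The coefficients are therefore cut off on the
  -- predictable event ‖r_t‖ ≤ N for every natural N, and each bounded path is covered by one of
  -- these countably many levels.
  have hk : ∀ (j : Fin n) (k : Fin m) (N : ℕ), ∀ᵐ ω ∂μ, ∃ l,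
      Tendsto (fun T => ∑ t ∈ Finset.range T,
        γ t ω * (if ‖r t ω‖ ≤ N then v j t ω k else 0) * transitionNoise P x j t ω) atTop (𝓝 l) := by
    intro j k N
    have hw : ∀ t, Measurable[F t] fun ω => if ‖r t ω‖ ≤ N then v j t ω k else 0 := fun t =>
      Measurable.ite ((measurable_norm.comp (hr t)) measurableSet_Iic)
        ((measurable_pi_apply k).comp (hv j t)) measurable_const
    refine ae_exists_tendsto_sum_step_mul hγ (A := |A N|) (K := 1) hw (fun t ω => ?_)
      (fun t => MemLp.of_bound (measurable_transitionNoise (hx0 t) (hx0 (t + 1))).aestronglyMeasurable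
        1 (Eventually.of_forall (abs_transitionNoise_le hP j t)))
      (condExp_transitionNoise hP hx hM j) (condExp_sq_transitionNoise_le hP hx0 j) fun t => ?_
    · split_ifs with h
      · exact (norm_le_pi_norm (v j t ω) k).trans ((hA N j t ω h).trans (le_abs_self _))
      · rw [abs_zero]
        positivity
    · have h1 : Measurable[F t] fun ω => γ t ω * (if ‖r t ω‖ ≤ N then v j t ω k else 0) :=
        (hγ.adapted t).mul (hw t)
      exact (h1.mono (hF t) le_rfl).mul
        (measurable_transitionNoise ((hx t).mono (hF t) le_rfl) (hx (t + 1)))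
  filter_upwards [ae_all_iff.2 fun j => ae_all_iff.2 fun k => ae_all_iff.2 (hk j k)]
    with ω hω hb
  obtain ⟨Br, hBr⟩ := hb.exists_norm_le
  obtain ⟨N, hN⟩ := exists_nat_ge Br
  have hrN : ∀ t, ‖r t ω‖ ≤ N := fun t => (hBr _ ⟨t, rfl⟩).trans hN
  refine exists_tendsto_pi fun k => ?_
  choose l hl using fun j => hω j k N
  refine ⟨∑ j, l j, (tendsto_finsetSum Finset.univ fun j _ => hl j).congr fun T => ?_⟩
  rw [Finset.sum_comm]
  refine Finset.sum_congr rfl fun t _ => ?_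
  simp only [if_pos (hrN t), Pi.smul_apply, Finset.sum_apply, smul_eq_mul, Finset.mul_sum]
  refine Finset.sum_congr rfl fun j _ => ?_
  ring

end Noise

/-! ### Assembly of the almost sure statement. -/

theorem mainTheorem6 {n m : ℕ}
    -- the Markov chain under the fixed policy, its costs, and its stationary law
    (P : Matrix (Fin n) (Fin n) ℝ) (hP : P ∈ rowStochastic ℝ (Fin n)) (hPirr : P.IsIrreducible)
    (q : Fin n → ℝ) (hq : IsStationaryLaw P q) (c : Fin n → ℝ)
    -- the risk mapping; each measure in its multikernel is absolutely continuous
    (σ : Fin n → (Fin n → ℝ) → (Fin n → ℝ) → ℝ) (hσ : IsTransitionRiskMapping σ)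
    (hσac : ∀ i, ∀ μ ∈ riskMultikernel σ i (P i), ∀ j, P i j = 0 → μ j = 0)
    -- the features and the parameters
    (Φ : Matrix (Fin n) (Fin m) ℝ) (α lam : ℝ) (hα0 : 0 < α) (hα1 : α < 1)
    (hlam0 : 0 ≤ lam) (hlam1 : lam ≤ 1)
    (hcontr : α * (1 + distortionCoeff σ P) < 1)
    -- the states, iterates, stepsizes, observed risk estimates and their errors
    {Ω : Type*} [MeasurableSpace Ω] (μ : Measure Ω) [IsProbabilityMeasure μ]
    (x : ℕ → Ω → Fin n) (r : ℕ → Ω → Fin m → ℝ) (γ σhat ξ : ℕ → Ω → ℝ)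
    (hx : ∀ t, Measurable (x t)) (hr : ∀ t, Measurable (r t))
    (hMarkov : IsMarkovTrajectory μ (historySigma x r) P x)
    (hγ : StepsizeConditions μ (historySigma x r) γ)
    (hσhat : ∀ t ω, σhat t ω = σ (x t ω) (P (x t ω)) (Φ *ᵥ r t ω) + ξ t ω)
    (hξ : ErrorConditions μ (historySigma x r) ξ)
    -- the method: `r_{t+1} = r_t - γ_t z_t d̃_t`, `d̃_t = φ(x_t)ᵀ r_t - c(x_t) - α σ̃_t`
    (hstep : ∀ t ω, r (t + 1) ω = r t ω -
      (γ t ω * (Φ (x t ω) ⬝ᵥ r t ω - c (x t ω) - α * σhat t ω)) •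
        eligibilityTrace Φ (lam * α) (fun s => x s ω) t)
    (hbdd : ∀ᵐ ω ∂μ, Bornology.IsBounded (Set.range fun t => r t ω)) :
    ∀ᵐ ω ∂μ, ∀ r' : Fin m → ℝ, MapClusterPt r' atTop (fun t => r t ω) →
      SolvesProjectedMultistepEquation σ P q c Φ α lam r' := by
  obtain ⟨Z, hZ⟩ := exists_poisson_matrix hP hPirr hq
  have hqpos := hq.pos hPirr
  set β := lam * α
  have hβ0 : 0 ≤ β := mul_nonneg hlam0 hα0.le
  have hβ1 : β < 1 := (mul_le_of_le_one_left hα0.le hlam1).trans_lt hα1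
  set z : ℕ → Ω → Fin m → ℝ := fun t ω => eligibilityTrace Φ β (fun s => x s ω) t
  set g := temporalDifference σ P c Φ α
  let F : Filtration ℕ _ := historyFiltration hx hr
  have hxF : ∀ t, Measurable[F t] (x t) := fun t => measurable_state_historySigma le_rfl
  have hrF : ∀ t, Measurable[F t] (r t) := fun t => measurable_iterate_historySigma le_rfl
  have hzF : ∀ t, Measurable[F t] (z t) := fun t => measurable_eligibilityTrace Φ β le_rfl
  have hgc : Continuous g := continuous_temporalDifference hP hσ c Φ α
  have hrec : ∀ t ω, r (t + 1) ω =
      r t ω - (γ t ω * (g (r t ω) (x t ω) - α * ξ t ω)) • z t ω := by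
    intro t ω
    rw [hstep t ω, hσhat t ω]
    congr 3
    simp only [g, temporalDifference, riskOperator, Pi.sub_apply, Pi.smul_apply, smul_eq_mul, mulVec]
    ring
  obtain ⟨Bz, hBz0, hBz⟩ := exists_norm_eligibilityTrace_le Φ hβ0 hβ1
  obtain ⟨C, hC0, hC⟩ := exists_norm_tracePotential_le P Z Φ β
  obtain ⟨L, hL0, hL⟩ := exists_lipschitz_temporalDifference hP hσ c Φ α
  obtain ⟨K, hK⟩ := hξ.variance_bound
  have hError := ae_exists_tendsto_sum_error (F := F) hγ hξ hxF hrF hzF (fun t ω => hBz _ t) hgc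
    hα0.ne' hrec
  have hv : ∀ j t, Measurable[F t] fun ω =>
      tracePotential P Z Φ β (β • z t ω + Φ j) j (g (r t ω)) := fun j t => by
    have h1 : Measurable[F t] fun ω => (β • z t ω + Φ j, g (r t ω)) :=
      (((hzF t).const_smul β).add_const (Φ j)).prodMk (hgc.measurable.comp (hrF t))
    have h2 := (continuous_tracePotential P Z Φ β j).measurable.comp h1
    exact h2
  have hNoise := ae_exists_tendsto_sum_transitionNoise (F := F) hP hMarkov hγ hxF hrF
    (v := fun j t ω => tracePotential P Z Φ β (β • z t ω + Φ j) j (g (r t ω)))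
    (A := fun R => C * (β * Bz + (∑ j, ‖Φ j‖) + 1) * (‖g 0‖ + L * R))
    hv
    (fun R j t ω hR => by
      refine (hC _ _ _).trans ?_
      have h1 : ‖β • z t ω + Φ j‖ ≤ β * Bz + ∑ j, ‖Φ j‖ := by
        refine (norm_add_le _ _).trans (add_le_add ?_ (Finset.single_le_sum (f := fun j => ‖Φ j‖)
          (fun _ _ => norm_nonneg _) (Finset.mem_univ j)))
        rw [norm_smul, Real.norm_of_nonneg hβ0]
        exact mul_le_mul_of_nonneg_left (hBz _ t) hβ0
      have h2 : ‖g (r t ω)‖ ≤ ‖g 0‖ + L * R := by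
        have h3 := hL (r t ω) 0
        rw [sub_zero] at h3
        have h4 := norm_le_norm_add_norm_sub' (g (r t ω)) (g 0)
        have h5 := mul_le_mul_of_nonneg_left hR hL0
        linarith
      have h6 : 0 ≤ ∑ j, ‖Φ j‖ := Finset.sum_nonneg fun _ _ => norm_nonneg _
      gcongr)
  -- The slow variation condition is taken at ε = 2, the largest total stepsize of the windows in
  -- the contraction argument.
  filter_upwards [hγ.pos, hγ.tendsto_zero, hγ.sum_eq_top, hγ.slowly_varying 2 (by norm_num),
    ae_summable_step_sq (F := F) hγ, ae_summable_sq_step_mul (F := F) hγ hξ.memLp hK, hError, hNoise,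
    hbdd] with ω hpos h0 hsum hslow hsq hξsq hξω hDω hbω r' hr'
  obtain ⟨Br, hBr⟩ := hbω.exists_norm_le
  exact solves_of_path hP hq hqpos c hσ hσac Φ hα0 hα1 hlam0 hlam1 hcontr hZ
    (x := fun t => x t ω) (r := fun t => r t ω) (γ := fun t => γ t ω) (ξ := fun t => ξ t ω)
    (fun t => hrec t ω) (fun t => hBr _ ⟨t, rfl⟩) hpos h0 hsum hslow hsq hξsq hξω (hDω hbω) hr'
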